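/- Let $k$ be a field and let $C$ be a finite-dimensional $k$-algebra of global dimension at most $2$. Modules are finitely generated right modules. Let $D=\operatorname{Hom}_k(-,k)$. For a finite-dimensional $k$-algebra $\Lambda$, the space $\operatorname{Ext}^2_\Lambda(D\Lambda,\Lambda)$ of extensions of right modules is a $\Lambda$-bimodule: the left action is induced by left multiplication on $\Lambda$, the right action by the left action $(c\cdot f)(x)=f(xc)$ on $D\Lambda$. Let $R(\Lambda)=\Lambda\ltimes \operatorname{Ext}^2_\Lambda(D\Lambda,\Lambda)$ be the trivial extension, with product $(c,g)(c',g')=(cc',cg'+gc')$; for $\Lambda$ of global dimension at most $2$ this is the relation extension of $\Lambda$. For a right $\Lambda$-module $M$, the one-point extension of $\Lambda$ by $M$ is the triangular matrix algebra $$\Lambda[M]=\begin{bmatrix}\Lambda&0\\ M&k\end{bmatrix},\qquad \begin{bmatrix}a&0\\ m&\mu\end{bmatrix}\begin{bmatrix}a'&0\\ m'&\mu'\end{bmatrix}=\begin{bmatrix}aa'&0\\ ma'+\mu m'&\mu\mu'\end{bmatrix}.$$ Let $e_1,\dots,e_n$ be a complete set of primitive orthogonal idempotents of $C$, and let $P_C(j)=e_jC$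 and $P_{R(C)}(j)=(e_j,0)R(C)$. Let $P$ be a projective $C$-module. Then $P\cong\bigoplus_j a_jP_C(j)$ for some integers $a_1,\dots,a_n\ge 0$, where $aM$ denotes the direct sum of $a$ copies of $M$. For all such $a_1,\dots,a_n$, and for the projective $R(C)$-module $\overline P\cong\bigoplus_j a_jP_{R(C)}(j)$ with the same multiplicities, there is an isomorphism of $k$-algebras $$R(C[P])\cong R(C)[\overline P].$$ -/

import Mathlib

open MulOpposite CategoryTheory

universe u

/-! Right modules over a ring `A` are `Module Aᵐᵒᵖ M`; the right action `m · a` is `op a • m`. -/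

/-! ### The one-point extension -/

/-- The one-point extension `Λ[M]` of a `k`-algebra `Λ` by a right `Λ`-module `M`: the lower
triangular matrices with diagonal entries `a : Λ`, `μ : k` and lower left entry `m : M`. -/
@[ext]
structure OnePointExt (k : Type*) (Λ : Type*) (M : Type*) where
  /-- the upper left entry -/
  a : Λ
  /-- the lower left entry -/
  m : M
  /-- the lower right entry -/
  μ : k

namespace OnePointExt

set_option linter.unusedSectionVars false

variable {k Λ M : Type*} [Field k] [Ring Λ] [Algebra k Λ] [AddCommGroup M] [Module k M]
  [Module Λᵐᵒᵖ M] [IsScalarTower k Λᵐᵒᵖ M]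

instance : Zero (OnePointExt k Λ M) := ⟨⟨0, 0, 0⟩⟩
instance : One (OnePointExt k Λ M) := ⟨⟨1, 0, 1⟩⟩
instance : Add (OnePointExt k Λ M) := ⟨fun x y => ⟨x.a + y.a, x.m + y.m, x.μ + y.μ⟩⟩
instance : Neg (OnePointExt k Λ M) := ⟨fun x => ⟨-x.a, -x.m, -x.μ⟩⟩
/-- Matrix multiplication: the lower left entry is `m a' + μ m'`. -/
instance : Mul (OnePointExt k Λ M) :=
  ⟨fun x y => ⟨x.a * y.a, op y.a • x.m + x.μ • y.m, x.μ * y.μ⟩⟩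
instance : SMul k (OnePointExt k Λ M) := ⟨fun r x => ⟨r • x.a, r • x.m, r * x.μ⟩⟩

@[simp] theorem zero_a : (0 : OnePointExt k Λ M).a = 0 := rfl
@[simp] theorem zero_m : (0 : OnePointExt k Λ M).m = 0 := rfl
@[simp] theorem zero_μ : (0 : OnePointExt k Λ M).μ = 0 := rfl
@[simp] theorem one_a : (1 : OnePointExt k Λ M).a = 1 := rfl
@[simp] theorem one_m : (1 : OnePointExt k Λ M).m = 0 := rfl
@[simp] theorem one_μ : (1 : OnePointExt k Λ M).μ = 1 := rfl
@[simp] theorem add_a (x y : OnePointExt k Λ M) : (x + y).a = x.a + y.a := rfl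
@[simp] theorem add_m (x y : OnePointExt k Λ M) : (x + y).m = x.m + y.m := rfl
@[simp] theorem add_μ (x y : OnePointExt k Λ M) : (x + y).μ = x.μ + y.μ := rfl
@[simp] theorem neg_a (x : OnePointExt k Λ M) : (-x).a = -x.a := rfl
@[simp] theorem neg_m (x : OnePointExt k Λ M) : (-x).m = -x.m := rfl
@[simp] theorem neg_μ (x : OnePointExt k Λ M) : (-x).μ = -x.μ := rfl
@[simp] theorem mul_a (x y : OnePointExt k Λ M) : (x * y).a = x.a * y.a := rfl
@[simp] theorem mul_m (x y : OnePointExt k Λ M) :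
    (x * y).m = op y.a • x.m + x.μ • y.m := rfl
@[simp] theorem mul_μ (x y : OnePointExt k Λ M) : (x * y).μ = x.μ * y.μ := rfl
@[simp] theorem smul_a (r : k) (x : OnePointExt k Λ M) : (r • x).a = r • x.a := rfl
@[simp] theorem smul_m (r : k) (x : OnePointExt k Λ M) : (r • x).m = r • x.m := rfl
@[simp] theorem smul_μ (r : k) (x : OnePointExt k Λ M) : (r • x).μ = r * x.μ := rfl

/-- In a `k`-algebra the scalars of `k` commute with the right action. -/
theorem op_smul_smul_comm (r : k) (b : Λ) (m : M) : op b • r • m = r • op b • m := by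
  rw [← algebraMap_smul Λᵐᵒᵖ r m, ← algebraMap_smul Λᵐᵒᵖ r (op b • m), smul_smul, smul_smul,
    Algebra.commutes]

instance : Ring (OnePointExt k Λ M) where
  add_assoc x y z := by ext <;> simp [add_assoc]
  zero_add x := by ext <;> simp
  add_zero x := by ext <;> simp
  add_comm x y := by ext <;> simp [add_comm]
  neg_add_cancel x := by ext <;> simp
  nsmul := nsmulRec
  zsmul := zsmulRec
  left_distrib x y z := by ext <;> simp [mul_add, add_smul]; abel
  right_distrib x y z := by ext <;> simp [add_mul, add_smul]; abel
  zero_mul x := by ext <;> simp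
  mul_zero x := by ext <;> simp
  mul_assoc x y z := by
    ext <;> simp [mul_assoc, mul_smul, op_smul_smul_comm, add_assoc]
  one_mul x := by ext <;> simp
  mul_one x := by ext <;> simp

/-- The scalar `r` acts as the diagonal matrix with entries `r`, `r`. -/
instance : Algebra k (OnePointExt k Λ M) where
  algebraMap :=
    { toFun := fun r => ⟨algebraMap k Λ r, 0, r⟩
      map_one' := by ext <;> simp
      map_mul' := fun r s => by ext <;> simp
      map_zero' := by ext <;> simp
      map_add' := fun r s => by ext <;> simp }
  commutes' r x := by
    ext
    · exact Algebra.commutes r x.a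
    · change op x.a • (0 : M) + r • x.m = (algebraMap k Λᵐᵒᵖ r) • x.m + x.μ • (0 : M)
      rw [smul_zero, smul_zero, zero_add, add_zero, algebraMap_smul]
    · exact mul_comm r x.μ
  smul_def' r x := by
    ext
    · exact Algebra.smul_def r x.a
    · change r • x.m = op x.a • (0 : M) + r • x.m
      simp
    · rfl

end OnePointExt

/-! ### The relation extension -/

section RelationExtension

variable (k : Type u) [Field k] (C : Type u) [Ring C] [Algebra k C]

/-- The standard dual `DC = Hom_k(C, k)`. -/
def StdDual : Type u := C →ₗ[k] k

namespace StdDual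

instance : AddCommGroup (StdDual k C) := inferInstanceAs (AddCommGroup (C →ₗ[k] k))

variable {k C}

/-- An element of `DC`, as a linear form on `C`. -/
def lin (f : StdDual k C) : C →ₗ[k] k := f

/-- The left action of `c : C` on `DC`: `(c · f)(x) = f (x c)`. -/
def left (c : C) (f : StdDual k C) : StdDual k C :=
  LinearMap.comp f.lin (LinearMap.mulRight k c)

/-- The right action of `C` on `DC`: `(f · c)(x) = f (c x)`. -/
instance : Module Cᵐᵒᵖ (StdDual k C) where
  smul c f := LinearMap.comp f.lin (LinearMap.mulLeft k c.unop)
  one_smul f := LinearMap.ext fun x => congrArg f.lin (one_mul x)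
  mul_smul c d f :=
    LinearMap.ext fun x => congrArg f.lin (mul_assoc d.unop c.unop x)
  smul_zero _ := rfl
  smul_add _ _ _ := rfl
  add_smul c d f := LinearMap.ext fun x =>
    (congrArg f.lin (add_mul c.unop d.unop x)).trans (map_add _ _ _)
  zero_smul f := LinearMap.ext fun x =>
    (congrArg f.lin (zero_mul x)).trans (map_zero _)

/-- The left action of `c` on `DC`, as an endomorphism of the right module `DC`. -/
def leftHom (c : C) : StdDual k C →ₗ[Cᵐᵒᵖ] StdDual k C where
  toFun := left c
  map_add' _ _ := rfl
  map_smul' d f := LinearMap.ext fun x =>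
    congrArg f.lin (mul_assoc d.unop x c).symm

theorem leftHom_apply (c : C) (f : StdDual k C) (x : C) :
    (leftHom c f).lin x = f.lin (x * c) := rfl

theorem op_smul_apply (c : C) (f : StdDual k C) (x : C) :
    (op c • f).lin x = f.lin (c * x) := rfl

end StdDual

/-- Left multiplication by `c` on `C`, as an endomorphism of the right module `C`. -/
def regLeftHom {C : Type u} [Ring C] (c : C) : C →ₗ[Cᵐᵒᵖ] C where
  toFun x := c * x
  map_add' := mul_add c
  map_smul' d x := (mul_assoc c x d.unop).symm

/-- The group `Ext²_C(DC, C)` of right `C`-modules. -/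
def ExtBimod : Type u :=
  Abelian.Ext (ModuleCat.of Cᵐᵒᵖ (StdDual k C)) (ModuleCat.of Cᵐᵒᵖ C) 2

namespace ExtBimod

open Abelian

noncomputable instance : AddCommGroup (ExtBimod k C) :=
  inferInstanceAs (AddCommGroup (Ext (ModuleCat.of Cᵐᵒᵖ (StdDual k C)) (ModuleCat.of Cᵐᵒᵖ C) 2))

noncomputable instance : Module k (ExtBimod k C) :=
  inferInstanceAs (Module k (Ext (ModuleCat.of Cᵐᵒᵖ (StdDual k C)) (ModuleCat.of Cᵐᵒᵖ C) 2))

variable {k C}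

/-- The underlying class in Mathlib's `Ext`. -/
def toExt (e : ExtBimod k C) : Ext (ModuleCat.of Cᵐᵒᵖ (StdDual k C)) (ModuleCat.of Cᵐᵒᵖ C) 2 :=
  e

/-- Left multiplication by `c`, as a morphism `C ⟶ C` of right modules. -/
abbrev regMap (c : C) : ModuleCat.of Cᵐᵒᵖ C ⟶ ModuleCat.of Cᵐᵒᵖ C :=
  ModuleCat.ofHom (regLeftHom c)

/-- The left action of `c`, as a morphism `DC ⟶ DC` of right modules. -/
abbrev dualMap (c : C) :
    ModuleCat.of Cᵐᵒᵖ (StdDual k C) ⟶ ModuleCat.of Cᵐᵒᵖ (StdDual k C) :=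
  ModuleCat.ofHom (StdDual.leftHom c)

theorem regMap_one : regMap (1 : C) = 𝟙 _ := by
  refine ModuleCat.hom_ext (LinearMap.ext fun x => ?_); exact one_mul x

theorem regMap_mul (c d : C) : regMap (c * d) = regMap d ≫ regMap c := by
  refine ModuleCat.hom_ext (LinearMap.ext fun x => ?_); exact mul_assoc c d x

theorem regMap_add (c d : C) : regMap (c + d) = regMap c + regMap d := by
  refine ModuleCat.hom_ext (LinearMap.ext fun x => ?_); exact add_mul c d x

theorem regMap_zero : regMap (0 : C) = 0 := by
  refine ModuleCat.hom_ext (LinearMap.ext fun x => ?_); exact zero_mul x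

/-- The `k`-action on morphisms of right `C`-modules. -/
def homSMul {X Y : ModuleCat.{u} Cᵐᵒᵖ} (r : k) (f : X ⟶ Y) : X ⟶ Y := r • f

theorem mk₀_homSMul {X Y : ModuleCat.{u} Cᵐᵒᵖ} (r : k) (f : X ⟶ Y) :
    Ext.mk₀ (homSMul r f) = r • Ext.mk₀ f := Ext.mk₀_smul r f

theorem regMap_smul (r : k) (c : C) : regMap (r • c) = homSMul r (regMap c) := by
  refine ModuleCat.hom_ext (LinearMap.ext fun x => ?_)
  exact (show ∀ y : C, r • c * y = c * y * algebraMap k C r from fun y => by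
    rw [smul_mul_assoc, Algebra.smul_def, Algebra.commutes]) x

theorem dualMap_one : dualMap (k := k) (1 : C) = 𝟙 _ := by
  refine ModuleCat.hom_ext (LinearMap.ext fun f => ?_)
  exact LinearMap.ext fun x => congrArg f.lin (mul_one x)

theorem dualMap_mul (c d : C) : dualMap (k := k) (c * d) = dualMap d ≫ dualMap c := by
  refine ModuleCat.hom_ext (LinearMap.ext fun f => ?_)
  exact LinearMap.ext fun x => congrArg f.lin (mul_assoc x c d).symm

theorem dualMap_add (c d : C) : dualMap (k := k) (c + d) = dualMap c + dualMap d := by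
  refine ModuleCat.hom_ext (LinearMap.ext fun f => ?_)
  exact LinearMap.ext fun x =>
    (congrArg f.lin (mul_add x c d)).trans (map_add _ _ _)

theorem dualMap_zero : dualMap (k := k) (0 : C) = 0 := by
  refine ModuleCat.hom_ext (LinearMap.ext fun f => ?_)
  exact LinearMap.ext fun x =>
    (congrArg f.lin (mul_zero x)).trans (map_zero _)

theorem dualMap_smul (r : k) (c : C) :
    dualMap (k := k) (r • c) = homSMul r (dualMap c) := by
  refine ModuleCat.hom_ext (LinearMap.ext fun f => ?_)
  refine LinearMap.ext fun x => ?_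
  change f.lin (x * r • c) =
    f.lin (algebraMap k C r * x * c)
  rw [mul_smul_comm, Algebra.smul_def, mul_assoc]

/-- The left `C`-action on `Ext²_C(DC, C)`, induced by left multiplication on the second
argument `C`. -/
noncomputable instance : Module C (ExtBimod k C) where
  smul c e := e.toExt.comp (Ext.mk₀ (regMap c)) (add_zero 2)
  one_smul e := by
    change Ext.comp e.toExt (Ext.mk₀ (regMap 1)) (add_zero 2) = e
    rw [regMap_one]; exact Ext.comp_mk₀_id _
  mul_smul c d e := by
    change Ext.comp e.toExt (Ext.mk₀ (regMap (c * d))) (add_zero 2) =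
      Ext.comp (Ext.comp e.toExt (Ext.mk₀ (regMap d)) (add_zero 2))
        (Ext.mk₀ (regMap c)) (add_zero 2)
    rw [regMap_mul, ← Ext.mk₀_comp_mk₀, Ext.comp_assoc_of_third_deg_zero]
  smul_zero c := Ext.zero_comp _ _ (Ext.mk₀ (regMap c)) _ (add_zero 2)
  smul_add c e f := Ext.add_comp _ _ _ _
  add_smul c d e := by
    change Ext.comp e.toExt (Ext.mk₀ (regMap (c + d))) (add_zero 2) = _
    rw [regMap_add, Ext.mk₀_add, Ext.comp_add]; rfl
  zero_smul e := by
    change Ext.comp e.toExt (Ext.mk₀ (regMap 0)) (add_zero 2) = _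
    rw [regMap_zero, Ext.mk₀_zero, Ext.comp_zero]; rfl

/-- The right `C`-action on `Ext²_C(DC, C)`, induced by the left action on the first
argument `DC`. -/
noncomputable instance : Module Cᵐᵒᵖ (ExtBimod k C) where
  smul c e := Ext.comp (Ext.mk₀ (dualMap (k := k) c.unop)) e.toExt (zero_add 2)
  one_smul e := by
    change Ext.comp (Ext.mk₀ (dualMap (k := k) 1)) e.toExt (zero_add 2) = e
    rw [dualMap_one]; exact Ext.mk₀_id_comp _
  mul_smul c d e := by
    change Ext.comp (Ext.mk₀ (dualMap (k := k) (d.unop * c.unop))) e.toExt (zero_add 2) =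
      Ext.comp (Ext.mk₀ (dualMap (k := k) c.unop))
        (Ext.comp (Ext.mk₀ (dualMap (k := k) d.unop)) e.toExt (zero_add 2)) (zero_add 2)
    rw [dualMap_mul, Ext.mk₀_comp_mk₀_assoc]
  smul_zero c := Ext.comp_zero (Ext.mk₀ (dualMap (k := k) c.unop)) _ 2 2 (zero_add 2)
  smul_add c e f := Ext.comp_add _ _ _ _
  add_smul c d e := by
    change Ext.comp (Ext.mk₀ (dualMap (k := k) (c.unop + d.unop))) e.toExt
      (zero_add 2) = _
    rw [dualMap_add, Ext.mk₀_add, Ext.add_comp]; rfl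
  zero_smul e := by
    change Ext.comp (Ext.mk₀ (dualMap (k := k) 0)) e.toExt (zero_add 2) = _
    rw [dualMap_zero, Ext.mk₀_zero, Ext.zero_comp]; rfl

theorem smul_def (c : C) (e : ExtBimod k C) :
    c • e = Ext.comp e.toExt (Ext.mk₀ (regMap c)) (add_zero 2) := rfl

theorem op_smul_def (c : C) (e : ExtBimod k C) :
    op c • e = Ext.comp (Ext.mk₀ (dualMap (k := k) c)) e.toExt (zero_add 2) := rfl

instance : SMulCommClass C Cᵐᵒᵖ (ExtBimod k C) where
  smul_comm c d e := by
    change Ext.comp (Ext.comp (Ext.mk₀ (dualMap (k := k) d.unop)) e.toExt (zero_add 2))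
        (Ext.mk₀ (regMap c)) (add_zero 2) =
      Ext.comp (Ext.mk₀ (dualMap (k := k) d.unop))
        (Ext.comp e.toExt (Ext.mk₀ (regMap c)) (add_zero 2)) (zero_add 2)
    rw [Ext.comp_assoc_of_third_deg_zero]

instance : IsScalarTower k C (ExtBimod k C) where
  smul_assoc r c e := by
    change Ext.comp e.toExt (Ext.mk₀ (regMap (r • c))) (add_zero 2) =
      r • Ext.comp e.toExt (Ext.mk₀ (regMap c)) (add_zero 2)
    rw [regMap_smul, mk₀_homSMul, Ext.comp_smul]

instance : IsScalarTower k Cᵐᵒᵖ (ExtBimod k C) where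
  smul_assoc r c e := by
    change Ext.comp (Ext.mk₀ (dualMap (k := k) (r • c.unop))) e.toExt (zero_add 2) =
      r • Ext.comp (Ext.mk₀ (dualMap (k := k) c.unop)) e.toExt (zero_add 2)
    rw [dualMap_smul, mk₀_homSMul, Ext.smul_comp]

end ExtBimod

/-- The relation extension `R(C) = C ⋉ Ext²_C(DC, C)`: pairs `(c, g)` with
`(c, g)(c', g') = (cc', cg' + gc')`. -/
abbrev RelExt : Type u := TrivSqZeroExt C (ExtBimod k C)

end RelationExtension

/-! ### Global dimension, idempotents and multiplicities -/

/-- The (right) global dimension of `A` is at most `d`: every finitely generated right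
`A`-module has projective dimension at most `d`. -/
def GlobalDimLE (A : Type u) [Ring A] (d : ℕ) : Prop :=
  ∀ M : ModuleCat.{u} Aᵐᵒᵖ, Module.Finite Aᵐᵒᵖ M → HasProjectiveDimensionLE M d

/-- `e` is a primitive idempotent: nonzero, and not a sum of two nonzero orthogonal
idempotents. -/
def IsPrimitiveIdem {A : Type*} [Ring A] (e : A) : Prop :=
  IsIdempotentElem e ∧ e ≠ 0 ∧
    ∀ f g : A, IsIdempotentElem f → IsIdempotentElem g → f * g = 0 → g * f = 0 →
      f + g = e → f = 0 ∨ g = 0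

/-- The right module `eA`; for a primitive idempotent `e`, the indecomposable projective at the
vertex given by `e`. -/
abbrev idemProj {A : Type*} [Ring A] (e : A) : Submodule Aᵐᵒᵖ A := Submodule.span Aᵐᵒᵖ {e}

/-- `M ≅ ⨁ⱼ aⱼ (eⱼ A)` as right `A`-modules: the summand `eⱼ A` occurs `a j` times in `M`. -/
def HasMultiplicities {A : Type*} [Ring A] {n : ℕ} (e : Fin n → A) (a : Fin n → ℕ)
    (M : Type*) [AddCommGroup M] [Module Aᵐᵒᵖ M] : Prop :=
  Nonempty (M ≃ₗ[Aᵐᵒᵖ] ((j : Fin n) → Fin (a j) → idemProj (e j)))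

/-!
Write `B = C[P]`, let `π : B → C` be the projection and let `ε = diag(1, 0)`. Inflation along `π`
embeds the right `C`-modules in the right `B`-modules; it is exact and fully faithful, and it
preserves projectives because `C = ε B` is projective over `B`. So it induces isomorphisms on `Ext`
(`Functor.mapExt_bijective_of_preservesProjectiveObjects`).

The right `B`-modules `Z` killed by `ε` are direct sums of copies of the simple module at the
extension vertex. They are invisible to the second `Ext` group, for two reasons:
* `Extⁿ(X, Z) = 0` for every inflated `X` (`subsingleton_ext_inflation`), as a projective resolution
  of `X` by inflated modules admits no nonzero map to `Z`;
* `Z` has projective dimension at most one (`hasProjectiveDimensionLT_two`), as the simple module is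
  `(0, P, k) / (0, P, 0)` and `P` is projective.

Both `B / B ε` and `DB / DC` are killed by `ε`, where `DC` embeds in `DB` by composition with `π` and
`B ε` is the inflation of `C × P`. Hence `Ext²_B(DB, B) ≅ Ext²_B(DC, B) ≅ Ext²_C(DC, C × P)`
(`extEquiv`), and left multiplication by `(c, p, μ)` on `B ε` becomes the obvious endomorphism of
`C × P`, while on the other side `B` acts through `π` (`extEquiv_smul`, `extEquiv_op_smul`).
Regrouping the components of `B ⋉ Ext²_B(DB, B)` turns it into the one-point extension of `R(C)` by
the right `R(C)`-module `P × Ext²_C(DC, P)` (`nonempty_relExt_algEquiv`).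

The construction `M ↦ M × Ext²_C(DC, M)` (`ExtInduced`) is an additive functor that sends `C` to
`R(C)`, and therefore `eC` to `(e, 0) R(C)` for an idempotent `e`. Applied to a decomposition of `P`
it gives the module with the same multiplicities over `R(C)`
(`nonempty_equiv_of_hasMultiplicities`). That a decomposition of `P` exists is the standard argument
with Fitting's lemma (`exists_hasMultiplicities`).
-/

/-! ### Decomposition of projective modules into the modules `eA` -/

section KrullSchmidt

variable {A : Type*} [Ring A]

theorem mem_idemProj_iff {e : A} (he : IsIdempotentElem e) {x : A} :
    x ∈ idemProj e ↔ e * x = x := by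
  rw [Submodule.mem_span_singleton]
  constructor
  · rintro ⟨c, rfl⟩
    change e * (e * c.unop) = e * c.unop
    rw [← mul_assoc, he.eq]
  · intro h
    exact ⟨op x, h⟩

/-- For a primitive idempotent `e`, the module `eA` is indecomposable: the components of `e` in a
decomposition `eA = U ⊕ V` are orthogonal idempotents with sum `e`. -/
theorem IsPrimitiveIdem.eq_bot_or_eq_bot_of_isCompl {e : A} (he : IsPrimitiveIdem e)
    {U V : Submodule Aᵐᵒᵖ (idemProj e)} (h : IsCompl U V) : U = ⊥ ∨ V = ⊥ := by
  obtain ⟨hid, -, hprim⟩ := he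
  let e' : idemProj e := ⟨e, Submodule.mem_span_singleton_self e⟩
  have hgen : ∀ x : idemProj e, op (x : A) • e' = x := fun x =>
    Subtype.ext ((mem_idemProj_iff hid).1 x.2)
  obtain ⟨u, hu, v, hv, huv⟩ : ∃ u ∈ U, ∃ v ∈ V, u + v = e' :=
    Submodule.mem_sup.1 (h.sup_eq_top ▸ Submodule.mem_top)
  have key : ∀ {U V : Submodule Aᵐᵒᵖ (idemProj e)}, IsCompl U V → ∀ u ∈ U, ∀ v ∈ V,
      u + v = e' → (u : A) * u = u ∧ (v : A) * u = 0 := by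
    intro U V h u hu v hv huv
    have h1 : op (u : A) • u + op (u : A) • v = u := by rw [← smul_add, huv, hgen]
    have h2 : op (u : A) • v = u - op (u : A) • u := by rw [eq_sub_iff_add_eq, add_comm, h1]
    have h3 : op (u : A) • v = 0 := by
      refine (Submodule.mem_bot Aᵐᵒᵖ).1 (h.inf_eq_bot ▸ ⟨?_, V.smul_mem _ hv⟩)
      rw [h2]
      exact U.sub_mem hu (U.smul_mem _ hu)
    rw [h3, add_zero] at h1
    exact ⟨congrArg Subtype.val h1, congrArg Subtype.val h3⟩
  obtain ⟨huu, hvu⟩ := key h u hu v hv huv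
  obtain ⟨hvv, huv'⟩ := key h.symm v hv u hu (by rw [add_comm, huv])
  have htop : ∀ {W : Submodule Aᵐᵒᵖ (idemProj e)}, e' ∈ W → W = ⊤ := fun {W} hW =>
    eq_top_iff.2 fun x _ => hgen x ▸ W.smul_mem _ hW
  rcases hprim u v huu hvv huv' hvu (congrArg Subtype.val huv) with h0 | h0
  · have hu0 : u = 0 := Subtype.ext h0
    rw [hu0, zero_add] at huv
    exact Or.inl (eq_bot_of_isCompl_top (htop (huv ▸ hv) ▸ h))
  · have hv0 : v = 0 := Subtype.ext h0
    rw [hv0, add_zero] at huv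
    exact Or.inr (eq_bot_of_top_isCompl (htop (huv ▸ hu) ▸ h))

/-- Fitting's lemma: on an indecomposable module of finite length, an endomorphism that is not
nilpotent is bijective. -/
theorem bijective_of_forall_pow_ne_zero {R M : Type*} [Ring R] [AddCommGroup M] [Module R M]
    [IsNoetherian R M] [IsArtinian R M]
    (hM : ∀ U V : Submodule R M, IsCompl U V → U = ⊥ ∨ V = ⊥) (f : Module.End R M)
    (hf : ∀ n, f ^ n ≠ 0) : Function.Bijective f := by
  obtain ⟨n, hn, hn0⟩ := (f.eventually_isCompl_ker_pow_range_pow.and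
    (Filter.eventually_gt_atTop 0)).exists
  obtain ⟨m, rfl⟩ := Nat.exists_eq_succ_of_ne_zero hn0.ne'
  rcases hM _ _ hn with h | h
  · have hr : LinearMap.range (f ^ (m + 1)) = ⊤ := eq_top_of_bot_isCompl (h ▸ hn)
    constructor
    · have hi : Function.Injective (f ^ (m + 1)) := LinearMap.ker_eq_bot.1 h
      rw [pow_succ] at hi
      exact Function.Injective.of_comp (f := ⇑(f ^ m)) hi
    · have hs : Function.Surjective (f ^ (m + 1)) := LinearMap.range_eq_top.1 hr
      rw [pow_succ'] at hs
      exact Function.Surjective.of_comp (g := ⇑(f ^ m)) hs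
  · exact absurd (LinearMap.range_eq_bot.1 h) (hf _)

/-- A map with a section splits its source as the product of its target and its kernel. -/
def LinearMap.prodKerEquivOfSection {R M N : Type*} [Ring R] [AddCommGroup M] [Module R M]
    [AddCommGroup N] [Module R N] (g : M →ₗ[R] N) (s : N →ₗ[R] M) (h : ∀ x, g (s x) = x) :
    M ≃ₗ[R] N × LinearMap.ker g :=
  LinearEquiv.ofLinearMap
    (g.prod ((LinearMap.id - s.comp g).codRestrict _ fun x => by simp [h]))
    (s.coprod (LinearMap.ker g).subtype)
    (LinearMap.ext fun x => Prod.ext (by simp [h]) (Subtype.ext (by simp [h])))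
    (LinearMap.ext fun x => by simp)

/-- A nonzero finitely generated projective module has a direct summand `eA`: it has a simple
quotient, some `eA` maps onto that quotient, and lifting both surjections through each other gives
an endomorphism of `eA` that is not nilpotent. -/
theorem exists_equiv_idemProj_prod [IsNoetherianRing Aᵐᵒᵖ] [IsArtinianRing Aᵐᵒᵖ]
    {n : ℕ} {e : Fin n → A}
    (he : CompleteOrthogonalIdempotents e) (hprim : ∀ j, IsPrimitiveIdem (e j))
    (P : Type*) [AddCommGroup P] [Module Aᵐᵒᵖ P] [Module.Finite Aᵐᵒᵖ P]
    [Module.Projective Aᵐᵒᵖ P] [Nontrivial P] :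
    ∃ (j : Fin n) (K : Submodule Aᵐᵒᵖ P), K ≠ ⊤ ∧ Nonempty (P ≃ₗ[Aᵐᵒᵖ] idemProj (e j) × K) := by
  obtain ⟨N, hN, -⟩ := (eq_top_or_exists_le_coatom (⊥ : Submodule Aᵐᵒᵖ P)).resolve_left bot_ne_top
  have : IsSimpleModule Aᵐᵒᵖ (P ⧸ N) := isSimpleModule_iff_isCoatom.2 hN
  obtain ⟨p, hp⟩ : ∃ p, p ∉ N := by
    by_contra! h
    exact hN.1 (eq_top_iff.2 fun x _ => h x)
  obtain ⟨j, hj⟩ : ∃ j, op (e j) • p ∉ N := by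
    by_contra! h
    apply hp
    have : ∑ j, op (e j) • p = p := by
      rw [← Finset.sum_smul, ← Finset.op_sum, he.complete, op_one, one_smul]
    exact this ▸ N.sum_mem fun j _ => h j
  -- `h` and `g` are maps between `eA` and `P` over the simple quotient `P / N`.
  let h : idemProj (e j) →ₗ[Aᵐᵒᵖ] P :=
    { toFun := fun x => op (x : A) • p
      map_add' := fun x y => by simp [add_smul]
      map_smul' := fun c x => (mul_smul c (op (x : A)) p) }
  let e' : idemProj (e j) := ⟨e j, Submodule.mem_span_singleton_self _⟩
  have hne : N.mkQ ∘ₗ h ≠ 0 := fun h0 =>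
    hj ((Submodule.Quotient.mk_eq_zero N).1 (LinearMap.congr_fun h0 e'))
  obtain ⟨g, hg⟩ := Module.projective_lifting_property (N.mkQ ∘ₗ h) N.mkQ
    (LinearMap.surjective_of_ne_zero hne)
  have hgh : Function.Bijective (g ∘ₗ h) := by
    refine bijective_of_forall_pow_ne_zero
      (fun U V hUV => (hprim j).eq_bot_or_eq_bot_of_isCompl hUV) _ fun m hm => hne ?_
    have : ∀ m, (N.mkQ ∘ₗ h) ∘ₗ ((g ∘ₗ h : Module.End Aᵐᵒᵖ _) ^ m) = N.mkQ ∘ₗ h := by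
      intro m
      induction m with
      | zero => rfl
      | succ m ih =>
        rw [pow_succ, Module.End.mul_eq_comp, ← LinearMap.comp_assoc, ih, ← LinearMap.comp_assoc,
          hg]
    rw [← this m, hm, LinearMap.comp_zero]
  let f := LinearEquiv.ofBijective _ hgh
  refine ⟨j, LinearMap.ker g, fun hk => ?_,
    ⟨g.prodKerEquivOfSection (h ∘ₗ f.symm) fun x => f.apply_symm_apply x⟩⟩
  rw [LinearMap.ker_eq_top] at hk
  have : e' = 0 := hgh.1 (by rw [hk]; rfl)
  exact (hprim j).2.1 (congrArg Subtype.val this)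

theorem exists_equiv_pi_idemProj [IsNoetherianRing Aᵐᵒᵖ] [IsArtinianRing Aᵐᵒᵖ]
    {n : ℕ} {e : Fin n → A}
    (he : CompleteOrthogonalIdempotents e) (hprim : ∀ j, IsPrimitiveIdem (e j))
    (P : Type*) [AddCommGroup P] [Module Aᵐᵒᵖ P] [Module.Finite Aᵐᵒᵖ P]
    [Module.Projective Aᵐᵒᵖ P] :
    ∃ (ι : Type) (_ : Fintype ι) (s : ι → Fin n),
      Nonempty (P ≃ₗ[Aᵐᵒᵖ] ((i : ι) → idemProj (e (s i)))) := by
  suffices H : ∀ Q : Submodule Aᵐᵒᵖ P, Module.Projective Aᵐᵒᵖ Q →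
      ∃ (ι : Type) (_ : Fintype ι) (s : ι → Fin n),
        Nonempty (Q ≃ₗ[Aᵐᵒᵖ] ((i : ι) → idemProj (e (s i)))) by
    obtain ⟨ι, _, s, ⟨φ⟩⟩ := H ⊤ (.of_equiv' Submodule.topEquiv.symm)
    exact ⟨ι, ‹_›, s, ⟨Submodule.topEquiv.symm.trans φ⟩⟩
  intro Q
  induction Q using WellFoundedLT.induction with
  | ind Q ih =>
    intro hQ
    rcases subsingleton_or_nontrivial Q with hs | hs
    · exact ⟨Empty, inferInstance, Empty.elim, ⟨0, 0, fun _ => Subsingleton.elim _ _,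
        fun _ => Subsingleton.elim _ _⟩⟩
    · obtain ⟨j, K, hK, ⟨φ⟩⟩ := exists_equiv_idemProj_prod he hprim Q
      let ψ : K ≃ₗ[Aᵐᵒᵖ] K.map Q.subtype :=
        Submodule.equivMapOfInjective _ Q.injective_subtype K
      have hlt : K.map Q.subtype < Q := by
        refine lt_of_le_of_ne (Submodule.map_subtype_le _ _) fun h => hK ?_
        apply Submodule.map_injective_of_injective Q.injective_subtype
        rw [h, Submodule.map_subtype_top]
      have hKp : Module.Projective Aᵐᵒᵖ K :=
        .of_split (φ.symm.toLinearMap ∘ₗ LinearMap.inr _ _ _)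
          (LinearMap.snd _ _ _ ∘ₗ φ.toLinearMap) (LinearMap.ext fun x => by simp)
      obtain ⟨ι, _, s, ⟨χ⟩⟩ := ih _ hlt (.of_equiv' ψ)
      let χ' : (idemProj (e j) × K) ≃ₗ[Aᵐᵒᵖ]
          idemProj (e j) × ((i : ι) → idemProj (e (s i))) :=
        (LinearEquiv.refl _ _).prodCongr (ψ.trans χ)
      exact ⟨Option ι, inferInstance, fun i => i.elim j s,
        ⟨φ.trans (χ'.trans (LinearEquiv.piOptionEquivProd Aᵐᵒᵖ
          (M := fun i : Option ι => idemProj (e (i.elim j s)))).symm)⟩⟩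

theorem exists_hasMultiplicities [IsNoetherianRing Aᵐᵒᵖ] [IsArtinianRing Aᵐᵒᵖ]
    {n : ℕ} {e : Fin n → A}
    (he : CompleteOrthogonalIdempotents e) (hprim : ∀ j, IsPrimitiveIdem (e j))
    (P : Type*) [AddCommGroup P] [Module Aᵐᵒᵖ P] [Module.Finite Aᵐᵒᵖ P]
    [Module.Projective Aᵐᵒᵖ P] : ∃ a : Fin n → ℕ, HasMultiplicities e a P := by
  obtain ⟨ι, _, s, ⟨φ⟩⟩ := exists_equiv_pi_idemProj he hprim P
  classical
  let E : (Σ j, Fin (Fintype.card {i // s i = j})) ≃ ι :=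
    (Equiv.sigmaCongrRight fun j => (Fintype.equivFin {i // s i = j}).symm).trans
      (Equiv.sigmaFiberEquiv s)
  have hE : ∀ x, s (E x) = x.1 := fun x => ((Fintype.equivFin _).symm x.2).2
  let φ₁ : ((i : ι) → idemProj (e (s i))) ≃ₗ[Aᵐᵒᵖ]
      ((x : Σ j, Fin (Fintype.card {i // s i = j})) → idemProj (e (s (E x)))) :=
    (LinearEquiv.piCongrLeft Aᵐᵒᵖ (fun i => idemProj (e (s i))) E).symm
  let φ₂ : ((x : Σ j, Fin (Fintype.card {i // s i = j})) → idemProj (e (s (E x)))) ≃ₗ[Aᵐᵒᵖ]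
      ((x : Σ j, Fin (Fintype.card {i // s i = j})) → idemProj (e x.1)) :=
    LinearEquiv.piCongrRight fun x => LinearEquiv.ofEq _ _ (by rw [hE])
  exact ⟨fun j => Fintype.card {i // s i = j},
    ⟨φ.trans (φ₁.trans (φ₂.trans (LinearEquiv.piCurry Aᵐᵒᵖ fun j _ => idemProj (e j))))⟩⟩

end KrullSchmidt

/-! ### Restriction of scalars along a surjection -/

section RestrictScalars

open Limits

variable {R S : Type u} [Ring R] [Ring S] (f : R →+* S)

theorem restrictScalars_map_exact (T : ShortComplex (ModuleCat.{u} S)) (h : T.Exact) :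
    (T.map (ModuleCat.restrictScalars.{u} f)).Exact := by
  rw [ShortComplex.ShortExact.moduleCat_exact_iff_function_exact] at h ⊢
  exact h

theorem restrictScalars_preservesFiniteLimits :
    PreservesFiniteLimits (ModuleCat.restrictScalars.{u} f) := by
  have := ((Functor.exact_tfae (ModuleCat.restrictScalars.{u} f)).out 1 3).mp
    (restrictScalars_map_exact f)
  exact this.1

theorem restrictScalars_preservesFiniteColimits :
    PreservesFiniteColimits (ModuleCat.restrictScalars.{u} f) := by
  have := ((Functor.exact_tfae (ModuleCat.restrictScalars.{u} f)).out 1 3).mp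
    (restrictScalars_map_exact f)
  exact this.2

variable {f}

theorem restrictScalars_full (hf : Function.Surjective f) :
    (ModuleCat.restrictScalars.{u} f).Full where
  map_surjective {M N} g := by
    refine ⟨ModuleCat.ofHom
      { toFun := fun x => g.hom x
        map_add' := fun x y => g.hom.map_add x y
        map_smul' := fun s x => ?_ }, rfl⟩
    obtain ⟨r, rfl⟩ := hf s
    exact g.hom.map_smul r x

/-- Restriction along `f : R → S` preserves projectives if `f` has an `R`-linear section, that is, if
`S` is a direct summand of the `R`-module `R`. -/
theorem restrictScalars_projective (σ : S →+ R) (hσ : ∀ r s, σ (f r * s) = r * σ s)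
    (hfσ : ∀ s, f (σ s) = s) (M : ModuleCat.{u} S) [Module.Projective S M] :
    Module.Projective R ((ModuleCat.restrictScalars.{u} f).obj M) := by
  obtain ⟨s, hs⟩ := Module.projective_def.1 (inferInstance : Module.Projective S M)
  refine Module.projective_def.2 ⟨{
    toFun := fun x => Finsupp.mapRange.addMonoidHom σ (s x)
    map_add' := fun x y =>
      (congrArg (Finsupp.mapRange.addMonoidHom σ) (s.map_add x y)).trans (map_add _ _ _)
    map_smul' := fun r x => ?_ }, fun x => ?_⟩
  · ext i
    have h1 : s (r • x) = f r • s x := s.map_smul (f r) x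
    have h2 : σ (s (r • x) i) = r * σ (s x i) := by
      rw [h1]
      exact hσ _ _
    exact h2
  · refine Eq.trans ?_ (hs x)
    simp only [Finsupp.linearCombination_apply, LinearMap.coe_mk]
    refine (Finsupp.sum_mapRange_index (hf := map_zero σ) fun i => zero_smul R (id i)).trans ?_
    refine Finset.sum_congr rfl fun i _ => ?_
    have h1 : σ (s x i) • (id i : (ModuleCat.restrictScalars.{u} f).obj M) =
      f (σ (s x i)) • (id i : M) := rfl
    exact h1.trans (by rw [hfσ])

end RestrictScalars

/-! ### Inflation from `C` to `C[P]` -/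

namespace OnePointExt

open Abelian

variable (k C P : Type u) [Field k] [Ring C] [Algebra k C] [AddCommGroup P] [Module k P]
  [Module Cᵐᵒᵖ P] [IsScalarTower k Cᵐᵒᵖ P]

/-- The projection of `C[P]` onto `C`. -/
def toBase : OnePointExt k C P →+* C where
  toFun := a
  map_one' := rfl
  map_mul' _ _ := rfl
  map_zero' := rfl
  map_add' _ _ := rfl

/-- Inflation along `C[P] → C`, from right `C`-modules to right `C[P]`-modules. -/
noncomputable abbrev inflation : ModuleCat.{u} Cᵐᵒᵖ ⥤ ModuleCat.{u} (OnePointExt k C P)ᵐᵒᵖ :=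
  ModuleCat.restrictScalars.{u} (toBase k C P).op

theorem op_toBase_surjective : Function.Surjective (toBase k C P).op := fun c =>
  ⟨op ⟨c.unop, 0, 0⟩, rfl⟩

instance : Limits.PreservesFiniteLimits (inflation k C P) :=
  restrictScalars_preservesFiniteLimits _

instance : Limits.PreservesFiniteColimits (inflation k C P) :=
  restrictScalars_preservesFiniteColimits _

instance : (inflation k C P).Full := restrictScalars_full (op_toBase_surjective k C P)

theorem projective_inflation_obj (M : ModuleCat.{u} Cᵐᵒᵖ) [Module.Projective Cᵐᵒᵖ M] :
    Module.Projective (OnePointExt k C P)ᵐᵒᵖ ((inflation k C P).obj M) :=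
  let σ : Cᵐᵒᵖ →+ (OnePointExt k C P)ᵐᵒᵖ :=
    { toFun := fun c => op ⟨c.unop, 0, 0⟩
      map_zero' := rfl
      map_add' := fun c d =>
        unop_injective (OnePointExt.ext rfl (add_zero 0).symm (add_zero 0).symm) }
  restrictScalars_projective σ
    (fun r s => unop_injective (OnePointExt.ext rfl
      (show (0 : P) = op r.unop.a • (0 : P) + (0 : k) • r.unop.m by simp)
      (show (0 : k) = 0 * r.unop.μ by simp)))
    (fun _ => rfl) M

instance : (inflation k C P).PreservesProjectiveObjects where
  projective_obj {M} _ :=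
    have := projective_inflation_obj k C P M
    inferInstance

/-- The idempotent of `C[P]` with upper left entry `1`. -/
def baseIdem : OnePointExt k C P := ⟨1, 0, 0⟩

variable {k C P}

theorem baseIdem_smul_inflation {X : ModuleCat.{u} Cᵐᵒᵖ} (x : (inflation k C P).obj X) :
    op (baseIdem k C P) • x = x :=
  one_smul Cᵐᵒᵖ (show X from x)

/-- An inflated module has no extensions by a module on which `diag(1, 0)` acts as zero: there are
no nonzero maps, and inflation preserves projective presentations, so dimension shifting applies. -/
theorem subsingleton_ext_inflation {N : ModuleCat.{u} (OnePointExt k C P)ᵐᵒᵖ}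
    (hN : ∀ x : N, op (baseIdem k C P) • x = 0) (X : ModuleCat.{u} Cᵐᵒᵖ) (n : ℕ) :
    Subsingleton (Ext ((inflation k C P).obj X) N n) := by
  induction n generalizing X with
  | zero =>
    refine (Ext.homEquiv₀ (X := (inflation k C P).obj X) (Y := N)).subsingleton_congr.2
      ⟨fun f g => ?_⟩
    have : ∀ f : (inflation k C P).obj X ⟶ N, f = 0 := fun f =>
      ModuleCat.hom_ext (LinearMap.ext fun x => by
        rw [← baseIdem_smul_inflation x, map_smul, hN]
        rfl)
    rw [this f, this g]
  | succ n ih =>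
    let Q : ProjectivePresentation X := Classical.arbitrary _
    let T := ShortComplex.mk _ _ (Limits.kernel.condition Q.f)
    have hT : T.ShortExact := { exact := ShortComplex.exact_kernel Q.f }
    have hQ : Projective (T.map (inflation k C P)).X₂ :=
      Functor.PreservesProjectiveObjects.projective_obj (F := inflation k C P) Q.projective
    refine subsingleton_of_forall_eq 0 fun x => ?_
    obtain ⟨y, hy⟩ := Ext.contravariant_sequence_exact₃ (hT.map_of_exact (inflation k C P)) N x
      (Ext.eq_zero_of_projective _) (add_comm 1 n)
    obtain rfl : y = 0 := @Subsingleton.elim _ (ih (Limits.kernel Q.f)) _ _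
    exact hy.symm.trans (Ext.comp_zero _ _ _ _ _)

/-- On a module killed by `diag(1, 0)`, the algebra `C[P]` acts through its lower right entry. -/
theorem op_smul_eq_of_baseIdem_smul_eq_zero {Z : Type*} [AddCommGroup Z]
    [Module (OnePointExt k C P)ᵐᵒᵖ Z] (hZ : ∀ z : Z, op (baseIdem k C P) • z = 0)
    (b : OnePointExt k C P) (z : Z) : op b • z = op (algebraMap k (OnePointExt k C P) b.μ) • z := by
  have h : ∀ b : OnePointExt k C P, op b • z = op (⟨0, 0, b.μ⟩ : OnePointExt k C P) • z := by
    intro b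
    have : op b = op b * op (baseIdem k C P) +
        (op (baseIdem k C P) * op (⟨0, b.m, 0⟩ : OnePointExt k C P) +
          op (⟨0, 0, b.μ⟩ : OnePointExt k C P)) :=
      unop_injective (OnePointExt.ext (by simp [baseIdem]) (by simp [baseIdem])
        (by simp [baseIdem]))
    rw [this, add_smul, add_smul, mul_smul, hZ, smul_zero, zero_add, mul_smul, hZ, zero_add]
  rw [h b, h (algebraMap k _ b.μ)]
  rfl

variable (k C P) in
/-- The lower row of `C[P]`, that is, the right ideal of the elements `(0, m, μ)`, as a submodule of
the opposite ring. -/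
def lowerRow : Submodule (OnePointExt k C P)ᵐᵒᵖ (OnePointExt k C P)ᵐᵒᵖ where
  carrier := {r | r.unop.a = 0}
  zero_mem' := rfl
  add_mem' {x y} hx hy := by
    change x.unop.a + y.unop.a = 0
    rw [hx, hy, add_zero]
  smul_mem' r x hx := by
    change x.unop.a * r.unop.a = 0
    rw [hx, zero_mul]

variable (k C P) in
/-- The right ideal of the elements `(0, m, 0)` of `C[P]`, as a submodule of the opposite ring. It is
the inflation of `P`. -/
def corner : Submodule (OnePointExt k C P)ᵐᵒᵖ (OnePointExt k C P)ᵐᵒᵖ where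
  carrier := {r | r.unop.a = 0 ∧ r.unop.μ = 0}
  zero_mem' := ⟨rfl, rfl⟩
  add_mem' {x y} hx hy := by
    constructor
    · change x.unop.a + y.unop.a = 0
      rw [hx.1, hy.1, add_zero]
    · change x.unop.μ + y.unop.μ = 0
      rw [hx.2, hy.2, add_zero]
  smul_mem' r x hx := by
    constructor
    · change x.unop.a * r.unop.a = 0
      rw [hx.1, zero_mul]
    · change x.unop.μ * r.unop.μ = 0
      rw [hx.2, zero_mul]

theorem corner_le_lowerRow : corner k C P ≤ lowerRow k C P := fun _ h => h.1

instance : Module.Projective (OnePointExt k C P)ᵐᵒᵖ (lowerRow k C P) := by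
  refine Module.Projective.of_split (lowerRow k C P).subtype
    (LinearMap.codRestrict _ (LinearMap.toSpanSingleton (OnePointExt k C P)ᵐᵒᵖ _
      (op ⟨0, 0, 1⟩)) fun r => ?_) (LinearMap.ext fun r => Subtype.ext (unop_injective ?_))
  · change 0 * r.unop.a = 0
    exact zero_mul _
  · refine OnePointExt.ext ?_ ?_ ?_
    · exact (zero_mul _).trans r.2.symm
    · change op r.1.unop.a • (0 : P) + (1 : k) • r.1.unop.m = r.1.unop.m
      rw [smul_zero, zero_add, one_smul]
    · exact one_mul _

instance [Module.Projective Cᵐᵒᵖ P] :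
    Module.Projective (OnePointExt k C P)ᵐᵒᵖ (corner k C P) := by
  have := projective_inflation_obj k C P (ModuleCat.of Cᵐᵒᵖ P)
  exact Module.Projective.of_equiv' (R := (OnePointExt k C P)ᵐᵒᵖ)
    (M := (inflation k C P).obj (ModuleCat.of Cᵐᵒᵖ P))
    { toFun := fun p => ⟨op ⟨0, p, 0⟩, rfl, rfl⟩
      invFun := fun r => r.1.unop.m
      left_inv := fun _ => rfl
      right_inv := fun r => Subtype.ext (unop_injective (OnePointExt.ext r.2.1.symm rfl r.2.2.symm))
      map_add' := fun p q => Subtype.ext (unop_injective (OnePointExt.ext (add_zero 0).symm rfl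
        (add_zero 0).symm))
      map_smul' := fun r p => Subtype.ext (unop_injective (OnePointExt.ext (zero_mul _).symm
        (by
          change op r.unop.a • (show P from p) = op r.unop.a • (show P from p) + (0 : k) • r.unop.m
          rw [zero_smul, add_zero]) (zero_mul _).symm)) }

theorem projective_finsupp {R M : Type*} [Ring R] [AddCommGroup M] [Module R M]
    [Module.Projective R M] (ι : Type*) : Module.Projective R (ι →₀ M) := by
  classical
  exact .of_equiv' (finsuppLequivDFinsupp R).symm

/-- A module `Z` on which `diag(1, 0)` acts as zero has projective dimension at most one. A `k`-basis
of `Z` gives a projective resolution `0 → ⨁ corner → ⨁ lowerRow → Z → 0`. -/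
theorem hasProjectiveDimensionLT_two [Module.Projective Cᵐᵒᵖ P]
    {Z : ModuleCat.{u} (OnePointExt k C P)ᵐᵒᵖ}
    (hZ : ∀ z : Z, op (baseIdem k C P) • z = 0) : HasProjectiveDimensionLT Z 2 := by
  let : Module k Z := Module.compHom Z (algebraMap k (OnePointExt k C P)ᵐᵒᵖ)
  let v := Module.Basis.ofVectorSpace k Z
  have hsmul : ∀ (r : (OnePointExt k C P)ᵐᵒᵖ) (z : Z), r • z = r.unop.μ • z := fun r z =>
    op_smul_eq_of_baseIdem_smul_eq_zero hZ r.unop z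
  let g : (Module.Basis.ofVectorSpaceIndex k Z →₀ lowerRow k C P)
      →ₗ[(OnePointExt k C P)ᵐᵒᵖ] Z :=
    Finsupp.linearCombination _ v ∘ₗ Finsupp.mapRange.linearMap (lowerRow k C P).subtype
  let f : (Module.Basis.ofVectorSpaceIndex k Z →₀ corner k C P)
      →ₗ[(OnePointExt k C P)ᵐᵒᵖ] (Module.Basis.ofVectorSpaceIndex k Z →₀ lowerRow k C P) :=
    Finsupp.mapRange.linearMap (Submodule.inclusion corner_le_lowerRow)
  have hg : ∀ x, g x = Finsupp.linearCombination k v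
      (x.mapRange (fun r => r.1.unop.μ) rfl) := by
    intro x
    simp only [g, LinearMap.comp_apply, Finsupp.linearCombination_apply,
      Finsupp.mapRange.linearMap_apply]
    rw [Finsupp.sum_mapRange_index (fun i => zero_smul _ (v i)),
      Finsupp.sum_mapRange_index (fun i => zero_smul _ (v i))]
    exact Finset.sum_congr rfl fun i _ => hsmul _ _
  have hker : ∀ x, g x = 0 ↔ ∀ i, (x i).1.unop.μ = 0 := by
    intro x
    rw [hg, ← LinearMap.mem_ker, LinearMap.ker_eq_bot.2 v.linearIndependent, Submodule.mem_bot,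
      Finsupp.ext_iff]
    rfl
  have hfg : g ∘ₗ f = 0 := LinearMap.ext fun x => (hker _).2 fun i => (x i).2.2
  let f' : ModuleCat.of (OnePointExt k C P)ᵐᵒᵖ
      (Module.Basis.ofVectorSpaceIndex k Z →₀ corner k C P) ⟶
      ModuleCat.of (OnePointExt k C P)ᵐᵒᵖ
        (Module.Basis.ofVectorSpaceIndex k Z →₀ lowerRow k C P) := ModuleCat.ofHom f
  let g' : ModuleCat.of (OnePointExt k C P)ᵐᵒᵖ
      (Module.Basis.ofVectorSpaceIndex k Z →₀ lowerRow k C P) ⟶ Z := ModuleCat.ofHom g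
  have hT : (ShortComplex.mk f' g' (ModuleCat.hom_ext hfg)).ShortExact := by
    refine ModuleCat.shortComplex_shortExact _ ?_ ?_ ?_
    · refine fun x => ⟨fun hx => ?_, ?_⟩
      · have hx' := (hker x).1 hx
        refine ⟨Finsupp.onFinset x.support (fun i => ⟨(x i).1, (x i).2, hx' i⟩) ?_, ?_⟩
        · intro i hi
          rw [Finsupp.mem_support_iff]
          exact fun h0 => hi (Subtype.ext (show (x i).1 = 0 by rw [h0]; rfl))
        · exact Finsupp.ext fun i => rfl
      · rintro ⟨y, rfl⟩
        exact LinearMap.congr_fun hfg y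
    · exact Finsupp.mapRange_injective _ rfl (Submodule.inclusion_injective _)
    · intro z
      refine ⟨(v.repr z).mapRange (fun c => ⟨op ⟨0, 0, c⟩, rfl⟩) rfl, ?_⟩
      refine (hg _).trans ?_
      refine Eq.trans ?_ (v.linearCombination_repr z)
      congr 1
      exact Finsupp.ext fun i => rfl
  have h₁ : Projective (ModuleCat.of (OnePointExt k C P)ᵐᵒᵖ
      (Module.Basis.ofVectorSpaceIndex k Z →₀ corner k C P)) :=
    (IsProjective.iff_projective _).1 (projective_finsupp _)
  have h₂ : Projective (ModuleCat.of (OnePointExt k C P)ᵐᵒᵖ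
      (Module.Basis.ofVectorSpaceIndex k Z →₀ lowerRow k C P)) :=
    (IsProjective.iff_projective _).1 (projective_finsupp _)
  exact hT.hasProjectiveDimensionLT_X₃ 1
    (projective_iff_hasProjectiveDimensionLT_one.1 h₁)
    (haveI := projective_iff_hasProjectiveDimensionLT_one.1 h₂
     hasProjectiveDimensionLT_of_ge _ 1 2 (by norm_num))

/-- An injective map is part of a short exact sequence, with the kernel of the quotient map spelled
out on elements. -/
theorem exists_shortExact_of_mono {R : Type u} [Ring R] {M N : ModuleCat.{u} R} (f : M ⟶ N)
    (hf : Function.Injective f) :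
    ∃ (Z : ModuleCat.{u} R) (g : N ⟶ Z) (w : f ≫ g = 0), (ShortComplex.mk f g w).ShortExact ∧
      Function.Surjective g ∧ ∀ x, g x = 0 ↔ x ∈ Set.range f := by
  refine ⟨ModuleCat.of R (N ⧸ LinearMap.range f.hom),
    ModuleCat.ofHom (LinearMap.range f.hom).mkQ, ?_, ?_, Submodule.mkQ_surjective _, ?_⟩
  · exact ModuleCat.hom_ext (LinearMap.range_mkQ_comp _)
  · refine ModuleCat.shortComplex_shortExact _ ?_ hf (Submodule.mkQ_surjective _)
    exact LinearMap.exact_iff.2 (Submodule.ker_mkQ _)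
  · exact fun x => Submodule.Quotient.mk_eq_zero _

/-- If `W ⊆ N` contains `N · diag(1, 0)`, then restriction from `N` to `W` is bijective on second
extension groups, as `N / W` has projective dimension at most one. -/
theorem bijective_precomp_mk₀ [Module.Projective Cᵐᵒᵖ P]
    {W N : ModuleCat.{u} (OnePointExt k C P)ᵐᵒᵖ} (f : W ⟶ N) (hf : Function.Injective f)
    (hN : ∀ x : N, op (baseIdem k C P) • x ∈ Set.range f)
    (Y : ModuleCat.{u} (OnePointExt k C P)ᵐᵒᵖ) :
    Function.Bijective (fun x : Ext N Y 2 => (Ext.mk₀ f).comp x (zero_add 2)) := by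
  obtain ⟨Z, g, w, hT, hg, hker⟩ := exists_shortExact_of_mono f hf
  have hZ : ∀ z : Z, op (baseIdem k C P) • z = 0 := by
    intro z
    obtain ⟨x, rfl⟩ := hg z
    have := (hker _).2 (hN x)
    rwa [map_smul] at this
  have := hasProjectiveDimensionLT_two hZ
  constructor
  · refine (injective_iff_map_eq_zero ((Ext.mk₀ f).precomp Y (zero_add 2))).2 fun x hx => ?_
    obtain ⟨y, rfl⟩ := Ext.contravariant_sequence_exact₂ hT Y x hx
    rw [Ext.eq_zero_of_hasProjectiveDimensionLT y 2 le_rfl, Ext.comp_zero]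
  · intro y
    exact Ext.contravariant_sequence_exact₁ hT Y y (n₁ := 3) rfl
      (Ext.eq_zero_of_hasProjectiveDimensionLT _ 2 (by norm_num))

/-- If the inflation of `Y` is embedded in `N` and contains `N · diag(1, 0)`, then the extension
groups of an inflated module by `N` are those over `C` by `Y`. -/
theorem bijective_inflation_comp_mk₀ (X : ModuleCat.{u} Cᵐᵒᵖ) {Y : ModuleCat.{u} Cᵐᵒᵖ}
    {N : ModuleCat.{u} (OnePointExt k C P)ᵐᵒᵖ} (f : (inflation k C P).obj Y ⟶ N)
    (hf : Function.Injective f) (hN : ∀ x : N, op (baseIdem k C P) • x ∈ Set.range f) (n : ℕ) :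
    Function.Bijective (fun x : Ext X Y n =>
      (x.mapExactFunctor (inflation k C P)).comp (Ext.mk₀ f) (add_zero n)) := by
  have hF := (inflation k C P).mapExt_bijective_of_preservesProjectiveObjects X Y n
  refine Function.Bijective.comp (g := fun x => Ext.comp x (Ext.mk₀ f) (add_zero n)) ?_ hF
  obtain ⟨Z, g, w, hT, hg, hker⟩ := exists_shortExact_of_mono f hf
  have hZ : ∀ z : Z, op (baseIdem k C P) • z = 0 := by
    intro z
    obtain ⟨x, rfl⟩ := hg z
    have := (hker _).2 (hN x)
    rwa [map_smul] at this
  constructor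
  · refine (injective_iff_map_eq_zero ((Ext.mk₀ f).postcomp _ (add_zero n))).2 fun x hx => ?_
    cases n with
    | zero =>
      have : Mono f := (ModuleCat.mono_iff_injective f).2 hf
      exact (injective_iff_map_eq_zero ((Ext.mk₀ f).postcomp _ (add_zero 0))).1
        (Ext.postcomp_mk₀_injective_of_mono _ f) x hx
    | succ n =>
      obtain ⟨y, rfl⟩ := Ext.covariant_sequence_exact₁ _ hT x hx rfl
      rw [@Subsingleton.elim _ (subsingleton_ext_inflation hZ X n) y 0, Ext.zero_comp]
  · intro y
    exact Ext.covariant_sequence_exact₂ _ hT y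
      (@Subsingleton.elim _ (subsingleton_ext_inflation hZ X n) _ _)

end OnePointExt

/-! ### The right `R(C)`-module `M × Ext²(DC, M)` -/

section ExtInduced

open Abelian

variable {k C : Type u} [Field k] [Ring C] [Algebra k C]

/-- The orbit map `C → M`, `c ↦ p c`, of an element `p` of a right `C`-module `M`. -/
def orbitHom {M : ModuleCat.{u} Cᵐᵒᵖ} (p : M) : ModuleCat.of Cᵐᵒᵖ C ⟶ M :=
  ModuleCat.ofHom
    { toFun := fun c => op c • p
      map_add' := fun c d => add_smul (op c) (op d) p
      map_smul' := fun c d => mul_smul c (op d) p }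

theorem orbitHom_add {M : ModuleCat.{u} Cᵐᵒᵖ} (p q : M) :
    orbitHom (p + q) = orbitHom p + orbitHom q :=
  ModuleCat.hom_ext (LinearMap.ext fun c => smul_add (op c) p q)

theorem orbitHom_zero {M : ModuleCat.{u} Cᵐᵒᵖ} : orbitHom (0 : M) = 0 :=
  ModuleCat.hom_ext (LinearMap.ext fun c => smul_zero (op c))

theorem orbitHom_op_smul {M : ModuleCat.{u} Cᵐᵒᵖ} (c : C) (p : M) :
    orbitHom (op c • p) = ExtBimod.regMap c ≫ orbitHom p :=
  ModuleCat.hom_ext (LinearMap.ext fun d => (mul_smul (op d) (op c) p).symm)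

theorem orbitHom_comp {M N : ModuleCat.{u} Cᵐᵒᵖ} (p : M) (f : M ⟶ N) :
    orbitHom p ≫ f = orbitHom (f p) :=
  ModuleCat.hom_ext (LinearMap.ext fun c => f.hom.map_smul (op c) p)

variable (k) in
/-- The pairs in `M × Ext²_C(DC, M)`, as a right module over `R(C)` with
`(p, h) (c, g) = (p c, h c + p g)`; here `p g` is the image of `g` under the map `C → M` given by `p`.
For projective `M` this is `M ⊗_C R(C)`. -/
def ExtInduced (M : ModuleCat.{u} Cᵐᵒᵖ) : Type u :=
  M × Ext (ModuleCat.of Cᵐᵒᵖ (StdDual k C)) M 2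

namespace ExtInduced

open ExtBimod

variable {M N L : ModuleCat.{u} Cᵐᵒᵖ}

noncomputable instance : AddCommGroup (ExtInduced k M) :=
  inferInstanceAs (AddCommGroup (M × Ext (ModuleCat.of Cᵐᵒᵖ (StdDual k C)) M 2))

@[ext]
theorem ext {x y : ExtInduced k M} (h₁ : x.1 = y.1) (h₂ : x.2 = y.2) : x = y :=
  Prod.ext h₁ h₂

@[simp] theorem add_fst (x y : ExtInduced k M) : (x + y).1 = x.1 + y.1 := rfl
@[simp] theorem add_snd (x y : ExtInduced k M) : (x + y).2 = x.2 + y.2 := rfl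
@[simp] theorem zero_fst : (0 : ExtInduced k M).1 = 0 := rfl
@[simp] theorem zero_snd : (0 : ExtInduced k M).2 = 0 := rfl

noncomputable instance : SMul (RelExt k C)ᵐᵒᵖ (ExtInduced k M) where
  smul r x := ⟨op r.unop.fst • x.1,
    (Ext.mk₀ (dualMap (k := k) r.unop.fst)).comp x.2 (zero_add 2) +
      r.unop.snd.toExt.comp (Ext.mk₀ (orbitHom x.1)) (add_zero 2)⟩

@[simp] theorem smul_snd (r : (RelExt k C)ᵐᵒᵖ) (x : ExtInduced k M) :
    (r • x).2 = (Ext.mk₀ (dualMap (k := k) r.unop.fst)).comp x.2 (zero_add 2) +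
      r.unop.snd.toExt.comp (Ext.mk₀ (orbitHom x.1)) (add_zero 2) := rfl

noncomputable instance : Module (RelExt k C)ᵐᵒᵖ (ExtInduced k M) where
  one_smul x := by
    refine ext (one_smul Cᵐᵒᵖ x.1) ?_
    change (Ext.mk₀ (dualMap (k := k) (1 : C))).comp x.2 (zero_add 2) +
      (0 : Ext _ _ 2).comp (Ext.mk₀ (orbitHom x.1)) (add_zero 2) = x.2
    rw [dualMap_one, Ext.mk₀_id_comp, Ext.zero_comp, add_zero]
  mul_smul r s x := by
    refine ext (mul_smul (op r.unop.fst) (op s.unop.fst) x.1) ?_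
    change (Ext.mk₀ (dualMap (k := k) (s.unop.fst * r.unop.fst))).comp x.2 (zero_add 2) +
      (r.unop.snd.toExt.comp (Ext.mk₀ (regMap s.unop.fst)) (add_zero 2) +
        (Ext.mk₀ (dualMap (k := k) r.unop.fst)).comp s.unop.snd.toExt (zero_add 2)).comp
          (Ext.mk₀ (orbitHom x.1)) (add_zero 2) =
      (Ext.mk₀ (dualMap (k := k) r.unop.fst)).comp
        ((Ext.mk₀ (dualMap (k := k) s.unop.fst)).comp x.2 (zero_add 2) +
          s.unop.snd.toExt.comp (Ext.mk₀ (orbitHom x.1)) (add_zero 2)) (zero_add 2) +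
      r.unop.snd.toExt.comp (Ext.mk₀ (orbitHom (op s.unop.fst • x.1))) (add_zero 2)
    rw [dualMap_mul, orbitHom_op_smul, ← Ext.mk₀_comp_mk₀_assoc, ← Ext.mk₀_comp_mk₀, Ext.add_comp,
      Ext.comp_add, Ext.comp_assoc_of_third_deg_zero, Ext.comp_assoc_of_third_deg_zero]
    rw [add_assoc, add_comm (Ext.comp r.unop.snd.toExt _ _)]
  smul_zero r := by
    refine ext (smul_zero (op r.unop.fst)) ?_
    rw [smul_snd, zero_fst, zero_snd, orbitHom_zero, Ext.mk₀_zero, Ext.comp_zero, Ext.comp_zero,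
      add_zero]
  smul_add r x y := by
    refine ext (smul_add (op r.unop.fst) x.1 y.1) ?_
    simp only [smul_snd, add_fst, add_snd, orbitHom_add, Ext.mk₀_add, Ext.comp_add]
    abel
  add_smul r s x := by
    refine ext (add_smul (op r.unop.fst) (op s.unop.fst) x.1) ?_
    change (Ext.mk₀ (dualMap (k := k) (r.unop.fst + s.unop.fst))).comp x.2 (zero_add 2) +
      (r.unop.snd.toExt + s.unop.snd.toExt).comp (Ext.mk₀ (orbitHom x.1)) (add_zero 2) =
      ((r • x).2 + (s • x).2)
    simp only [smul_snd, dualMap_add, Ext.mk₀_add, Ext.add_comp]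
    abel
  zero_smul x := by
    refine ext (zero_smul Cᵐᵒᵖ x.1) ?_
    change (Ext.mk₀ (dualMap (k := k) (0 : C))).comp x.2 (zero_add 2) +
      (0 : Ext _ _ 2).comp (Ext.mk₀ (orbitHom x.1)) (add_zero 2) = 0
    rw [dualMap_zero, Ext.mk₀_zero, Ext.zero_comp, Ext.zero_comp, add_zero]

/-- The `R(C)`-linear map induced by a map of right `C`-modules. -/
noncomputable def map (f : M ⟶ N) : ExtInduced k M →ₗ[(RelExt k C)ᵐᵒᵖ] ExtInduced k N where
  toFun x := ⟨f x.1, x.2.comp (Ext.mk₀ f) (add_zero 2)⟩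
  map_add' x y := ext (f.hom.map_add x.1 y.1) (Ext.add_comp x.2 y.2 (Ext.mk₀ f) (add_zero 2))
  map_smul' r x := by
    refine ext (f.hom.map_smul (op r.unop.fst) x.1) ?_
    change ((Ext.mk₀ (dualMap (k := k) r.unop.fst)).comp x.2 (zero_add 2) +
        r.unop.snd.toExt.comp (Ext.mk₀ (orbitHom x.1)) (add_zero 2)).comp
          (Ext.mk₀ f) (add_zero 2) =
      (Ext.mk₀ (dualMap (k := k) r.unop.fst)).comp (x.2.comp (Ext.mk₀ f) (add_zero 2))
          (zero_add 2) +
        r.unop.snd.toExt.comp (Ext.mk₀ (orbitHom (f x.1))) (add_zero 2)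
    rw [Ext.add_comp, Ext.comp_assoc_of_third_deg_zero, Ext.comp_assoc_of_third_deg_zero,
      Ext.mk₀_comp_mk₀, orbitHom_comp]

@[simp] theorem map_snd (f : M ⟶ N) (x : ExtInduced k M) :
    (map f x).2 = x.2.comp (Ext.mk₀ f) (add_zero 2) := rfl

theorem map_id (x : ExtInduced k M) : map (𝟙 M) x = x := ext rfl (Ext.comp_mk₀_id _)

theorem map_map (f : M ⟶ N) (g : N ⟶ L) (x : ExtInduced k M) :
    map g (map f x) = map (f ≫ g) x :=
  ext rfl (by rw [map_snd, map_snd, map_snd, Ext.comp_assoc_of_third_deg_zero, Ext.mk₀_comp_mk₀])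

theorem map_zero_apply (x : ExtInduced k M) : map (0 : M ⟶ N) x = 0 :=
  ext rfl (by rw [map_snd, Ext.mk₀_zero, Ext.comp_zero]; rfl)

theorem map_add_apply (f g : M ⟶ N) (x : ExtInduced k M) : map (f + g) x = map f x + map g x :=
  ext rfl (by rw [map_snd, Ext.mk₀_add, Ext.comp_add]; rfl)

theorem map_sum_apply {ι : Type*} (s : Finset ι) (f : ι → (M ⟶ N)) (x : ExtInduced k M) :
    map (∑ i ∈ s, f i) x = ∑ i ∈ s, map (f i) x := by
  classical
  induction s using Finset.induction_on with
  | empty => simpa using map_zero_apply x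
  | insert i s hi ih => rw [Finset.sum_insert hi, Finset.sum_insert hi, map_add_apply, ih]

/-- The `R(C)`-linear equivalence induced by an isomorphism of right `C`-modules. -/
noncomputable def mapEquiv (f : M ≅ N) : ExtInduced k M ≃ₗ[(RelExt k C)ᵐᵒᵖ] ExtInduced k N :=
  LinearEquiv.ofLinearMap (map f.hom) (map f.inv)
    (LinearMap.ext fun x => by
      rw [LinearMap.comp_apply, map_map, f.inv_hom_id, map_id, LinearMap.id_apply])
    (LinearMap.ext fun x => by
      rw [LinearMap.comp_apply, map_map, f.hom_inv_id, map_id, LinearMap.id_apply])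

/-- `ExtInduced` commutes with finite products, since it is additive. -/
noncomputable def piEquiv {ι : Type} [Fintype ι] [DecidableEq ι] (M : ι → Type u)
    [∀ i, AddCommGroup (M i)] [∀ i, Module Cᵐᵒᵖ (M i)] :
    ExtInduced k (ModuleCat.of Cᵐᵒᵖ ((i : ι) → M i)) ≃ₗ[(RelExt k C)ᵐᵒᵖ]
      ((i : ι) → ExtInduced k (ModuleCat.of Cᵐᵒᵖ (M i))) :=
  LinearEquiv.ofLinearMap
    (LinearMap.pi fun i => map (ModuleCat.ofHom (LinearMap.proj i)))
    (∑ i, map (ModuleCat.ofHom (LinearMap.single Cᵐᵒᵖ M i)) ∘ₗ LinearMap.proj i)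
    (LinearMap.ext fun x => funext fun j => by
      simp only [LinearMap.comp_apply, LinearMap.pi_apply, LinearMap.sum_apply, map_sum, map_map,
        LinearMap.proj_apply, LinearMap.id_apply, ← ModuleCat.ofHom_comp]
      rw [Finset.sum_eq_single j]
      · rw [LinearMap.proj_comp_single_same]
        exact map_id _
      · intro i _ hij
        rw [LinearMap.proj_comp_single_ne _ _ _ _ hij.symm]
        exact map_zero_apply _
      · exact fun h => absurd (Finset.mem_univ j) h)
    (LinearMap.ext fun x => by
      simp only [LinearMap.comp_apply, LinearMap.pi_apply, LinearMap.sum_apply, map_map,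
        LinearMap.proj_apply, LinearMap.id_apply, ← ModuleCat.ofHom_comp, ← map_sum_apply]
      refine Eq.trans ?_ (map_id x)
      congr 1
      refine congrArg map (ModuleCat.hom_ext (LinearMap.ext fun y => ?_))
      rw [ModuleCat.hom_sum, LinearMap.sum_apply]
      exact Finset.univ_sum_single y)

variable (k C) in
/-- For `M = C` the module is the right regular module of `R(C)`; on elements this is the identity. -/
noncomputable def regularEquiv :
    ExtInduced k (ModuleCat.of Cᵐᵒᵖ C) ≃ₗ[(RelExt k C)ᵐᵒᵖ] RelExt k C where
  toFun x := show TrivSqZeroExt C (ExtBimod k C) from (x.1, x.2)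
  invFun r := ⟨r.fst, r.snd⟩
  left_inv _ := rfl
  right_inv _ := rfl
  map_add' _ _ := rfl
  map_smul' _ _ := TrivSqZeroExt.ext rfl (add_comm _ _)

/-- Left multiplication by `c` on `C` induces left multiplication by `(c, 0)` on `R(C)`. -/
theorem regularEquiv_map_regMap (c : C) (x : ExtInduced k (ModuleCat.of Cᵐᵒᵖ C)) :
    regularEquiv k C (map (regMap c) x) = TrivSqZeroExt.inl c * regularEquiv k C x := by
  refine TrivSqZeroExt.ext rfl ?_
  rw [TrivSqZeroExt.snd_mul, TrivSqZeroExt.snd_inl, smul_zero, add_zero]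
  rfl

/-- For an idempotent `e`, the module induced from `eC` is `(e, 0) R(C)`, both being the image of left
multiplication by `(e, 0)` on `R(C)`. -/
noncomputable def idemProjEquiv {e : C} (he : IsIdempotentElem e) :
    ExtInduced k (ModuleCat.of Cᵐᵒᵖ (idemProj e)) ≃ₗ[(RelExt k C)ᵐᵒᵖ]
      idemProj (TrivSqZeroExt.inl e : RelExt k C) :=
  let i : ModuleCat.of Cᵐᵒᵖ (idemProj e) ⟶ ModuleCat.of Cᵐᵒᵖ C :=
    ModuleCat.ofHom (idemProj e).subtype
  let r : ModuleCat.of Cᵐᵒᵖ C ⟶ ModuleCat.of Cᵐᵒᵖ (idemProj e) :=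
    ModuleCat.ofHom ((regLeftHom e).codRestrict _ fun c =>
      Submodule.mem_span_singleton.2 ⟨op c, rfl⟩)
  have hir : i ≫ r = 𝟙 _ := ModuleCat.hom_ext (LinearMap.ext fun x =>
    Subtype.ext ((mem_idemProj_iff he).1 x.2))
  have hri : r ≫ i = regMap e := rfl
  have he' : IsIdempotentElem (TrivSqZeroExt.inl e : RelExt k C) :=
    (TrivSqZeroExt.inl_mul_inl _ e e).trans (congrArg _ he.eq)
  LinearEquiv.ofLinearMap
    (((regularEquiv k C).toLinearMap ∘ₗ map i).codRestrict _ fun x =>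
      (mem_idemProj_iff he').2 (by
        rw [LinearMap.comp_apply, LinearEquiv.coe_coe, ← regularEquiv_map_regMap, map_map, ← hri,
          ← Category.assoc, hir, Category.id_comp]))
    (map r ∘ₗ (regularEquiv k C).symm.toLinearMap ∘ₗ Submodule.subtype _)
    (LinearMap.ext fun y => Subtype.ext (by
      refine Eq.trans ?_ ((mem_idemProj_iff he').1 y.2)
      change regularEquiv k C (map i (map r ((regularEquiv k C).symm y))) =
        TrivSqZeroExt.inl e * (y : RelExt k C)
      rw [map_map, hri, regularEquiv_map_regMap, LinearEquiv.apply_symm_apply]))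
    (LinearMap.ext fun x => by
      change map r ((regularEquiv k C).symm (regularEquiv k C (map i x))) = x
      rw [LinearEquiv.symm_apply_apply, map_map, hir, map_id])

/-- The module induced from `⨁ⱼ aⱼ (eⱼ C)` is `⨁ⱼ aⱼ ((eⱼ, 0) R(C))`. -/
theorem nonempty_equiv_of_hasMultiplicities {n : ℕ} {e : Fin n → C}
    (he : ∀ j, IsIdempotentElem (e j)) {a : Fin n → ℕ}
    {P : Type u} [AddCommGroup P] [Module Cᵐᵒᵖ P] (hP : HasMultiplicities e a P)
    {Q : Type u} [AddCommGroup Q] [Module (RelExt k C)ᵐᵒᵖ Q]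
    (hQ : HasMultiplicities (fun j => (TrivSqZeroExt.inl (e j) : RelExt k C)) a Q) :
    Nonempty (ExtInduced k (ModuleCat.of Cᵐᵒᵖ P) ≃ₗ[(RelExt k C)ᵐᵒᵖ] Q) := by
  obtain ⟨φ⟩ := hP
  obtain ⟨ψ⟩ := hQ
  let φ₁ : P ≃ₗ[Cᵐᵒᵖ] ((x : Σ j, Fin (a j)) → idemProj (e x.1)) :=
    φ.trans (LinearEquiv.piCurry Cᵐᵒᵖ fun j _ => idemProj (e j)).symm
  let ψ₁ : Q ≃ₗ[(RelExt k C)ᵐᵒᵖ]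
      ((x : Σ j, Fin (a j)) → idemProj (TrivSqZeroExt.inl (e x.1) : RelExt k C)) :=
    ψ.trans (LinearEquiv.piCurry (RelExt k C)ᵐᵒᵖ
      fun j (_ : Fin (a j)) => idemProj (TrivSqZeroExt.inl (e j) : RelExt k C)).symm
  let χ : ((x : Σ j, Fin (a j)) →
        ExtInduced k (ModuleCat.of Cᵐᵒᵖ (idemProj (e x.1)))) ≃ₗ[(RelExt k C)ᵐᵒᵖ]
      ((x : Σ j, Fin (a j)) → idemProj (TrivSqZeroExt.inl (e x.1) : RelExt k C)) :=
    LinearEquiv.piCongrRight fun x => idemProjEquiv (he x.1)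
  exact ⟨(mapEquiv φ₁.toModuleIso).trans ((piEquiv _).trans (χ.trans ψ₁.symm))⟩

end ExtInduced

end ExtInduced

/-! ### The extension bimodule of `C[P]` -/

namespace OnePointExt

open Abelian ExtBimod

section

variable (k C P : Type u) [Field k] [Ring C] [Algebra k C] [AddCommGroup P] [Module k P]
  [Module Cᵐᵒᵖ P] [IsScalarTower k Cᵐᵒᵖ P]

/-- The projection of `C[P]` onto `C`, as a `k`-linear map. -/
def toBaseLinear : OnePointExt k C P →ₗ[k] C where
  toFun b := b.a
  map_add' _ _ := rfl
  map_smul' _ _ := rfl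

/-- The embedding of the inflation of `DC` in `DB`, for `B = C[P]`: forms on `C` are composed with the
projection `B → C`. -/
noncomputable def inflationDual :
    (inflation k C P).obj (ModuleCat.of Cᵐᵒᵖ (StdDual k C)) ⟶
      ModuleCat.of (OnePointExt k C P)ᵐᵒᵖ (StdDual k (OnePointExt k C P)) :=
  ModuleCat.ofHom (R := (OnePointExt k C P)ᵐᵒᵖ)
    (X := (inflation k C P).obj (ModuleCat.of Cᵐᵒᵖ (StdDual k C)))
    { toFun := fun φ =>
        (show C →ₗ[k] k from φ).comp (toBaseLinear k C P)
      map_add' := fun _ _ => rfl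
      map_smul' := fun _ _ => rfl }

/-- The embedding of the inflation of `C × P` in `C[P]` as the left column, that is, as the right
ideal of the elements `(c, p, 0)`. -/
noncomputable def columnHom :
    (inflation k C P).obj (ModuleCat.of Cᵐᵒᵖ (C × P)) ⟶
      ModuleCat.of (OnePointExt k C P)ᵐᵒᵖ (OnePointExt k C P) :=
  ModuleCat.ofHom (R := (OnePointExt k C P)ᵐᵒᵖ)
    (X := (inflation k C P).obj (ModuleCat.of Cᵐᵒᵖ (C × P)))
    { toFun := fun x => ⟨(show C × P from x).1, (show C × P from x).2, 0⟩
      map_add' := fun _ _ => OnePointExt.ext rfl rfl (add_zero 0).symm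
      map_smul' := fun r x => OnePointExt.ext rfl
        (show op r.unop.a • (show C × P from x).2 =
          op r.unop.a • (show C × P from x).2 + (0 : k) • r.unop.m by rw [zero_smul, add_zero])
        (zero_mul r.unop.μ).symm }

/-- The first inclusion `C → C × P`, as a morphism of right modules. -/
abbrev inlHom : ModuleCat.of Cᵐᵒᵖ C ⟶ ModuleCat.of Cᵐᵒᵖ (C × P) :=
  ModuleCat.ofHom (LinearMap.inl Cᵐᵒᵖ C P)

/-- The second inclusion `P → C × P`, as a morphism of right modules. -/
abbrev inrHom : ModuleCat.of Cᵐᵒᵖ P ⟶ ModuleCat.of Cᵐᵒᵖ (C × P) :=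
  ModuleCat.ofHom (LinearMap.inr Cᵐᵒᵖ C P)

/-- The endomorphism of the right module `C × P` given by left multiplication by `b`. -/
def columnEnd (b : OnePointExt k C P) :
    ModuleCat.of Cᵐᵒᵖ (C × P) ⟶ ModuleCat.of Cᵐᵒᵖ (C × P) :=
  ModuleCat.ofHom
    { toFun := fun x => (b.a * x.1, op x.1 • b.m + b.μ • x.2)
      map_add' := fun x y => Prod.ext (mul_add _ _ _)
        (show op (x.1 + y.1) • b.m + b.μ • (x.2 + y.2) =
          (op x.1 • b.m + b.μ • x.2) + (op y.1 • b.m + b.μ • y.2) by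
            rw [MulOpposite.op_add, add_smul, smul_add, add_add_add_comm])
      map_smul' := fun c x => Prod.ext (mul_assoc _ _ _).symm
        (show op (x.1 * c.unop) • b.m + b.μ • c • x.2 = c • (op x.1 • b.m + b.μ • x.2) by
          rw [smul_add, op_mul, mul_smul, ← op_unop c, op_smul_smul_comm]; rfl) }

variable {k C P}

theorem columnHom_regMap (b : OnePointExt k C P) :
    columnHom k C P ≫ regMap b = (inflation k C P).map (columnEnd k C P b) ≫ columnHom k C P :=
  ModuleCat.hom_ext (LinearMap.ext fun _ => OnePointExt.ext rfl rfl (mul_zero b.μ))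

/-- On the submodule `DC` of `D(C[P])`, the left action of `C[P]` is that of `C`. -/
theorem inflationDual_dualMap (b : OnePointExt k C P) :
    inflationDual k C P ≫ dualMap (k := k) b =
      (inflation k C P).map (dualMap (k := k) b.a) ≫ inflationDual k C P := rfl

theorem inlHom_columnEnd (b : OnePointExt k C P) :
    inlHom C P ≫ columnEnd k C P b =
      regMap b.a ≫ inlHom C P + orbitHom (M := ModuleCat.of Cᵐᵒᵖ P) b.m ≫ inrHom C P :=
  ModuleCat.hom_ext (LinearMap.ext fun c => Prod.ext (add_zero (b.a * c)).symm
    (show op c • b.m + b.μ • (0 : P) = 0 + op c • b.m by rw [smul_zero, add_comm]))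

theorem inrHom_columnEnd (b : OnePointExt k C P) :
    inrHom C P ≫ columnEnd k C P b = homSMul b.μ (𝟙 _) ≫ inrHom C P :=
  ModuleCat.hom_ext (LinearMap.ext fun p => Prod.ext (mul_zero b.a)
    (show op (0 : C) • b.m + b.μ • p = algebraMap k Cᵐᵒᵖ b.μ • p by
      rw [op_zero, zero_smul, zero_add, algebraMap_smul]))

/-- `Ext²_C(DC, C × P)` is the product of `Ext²_C(DC, C)` and `Ext²_C(DC, P)`. -/
noncomputable def extColumnEquiv :
    ExtBimod k C × Ext (ModuleCat.of Cᵐᵒᵖ (StdDual k C)) (ModuleCat.of Cᵐᵒᵖ P) 2 ≃+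
      Ext (ModuleCat.of Cᵐᵒᵖ (StdDual k C)) (ModuleCat.of Cᵐᵒᵖ (C × P)) 2 where
  toFun x := x.1.toExt.comp (Ext.mk₀ (inlHom C P)) (add_zero 2) +
    x.2.comp (Ext.mk₀ (inrHom C P)) (add_zero 2)
  invFun y := (y.comp (Ext.mk₀ (ModuleCat.ofHom (LinearMap.fst Cᵐᵒᵖ C P))) (add_zero 2),
    y.comp (Ext.mk₀ (ModuleCat.ofHom (LinearMap.snd Cᵐᵒᵖ C P))) (add_zero 2))
  left_inv x := by
    have h1 : inlHom C P ≫ ModuleCat.ofHom (LinearMap.fst Cᵐᵒᵖ C P) = 𝟙 _ := rfl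
    have h2 : inrHom C P ≫ ModuleCat.ofHom (LinearMap.fst Cᵐᵒᵖ C P) = 0 := rfl
    have h3 : inlHom C P ≫ ModuleCat.ofHom (LinearMap.snd Cᵐᵒᵖ C P) = 0 := rfl
    have h4 : inrHom C P ≫ ModuleCat.ofHom (LinearMap.snd Cᵐᵒᵖ C P) = 𝟙 _ := rfl
    refine Prod.ext ?_ ?_
    · simp only [Ext.add_comp, Ext.comp_assoc_of_third_deg_zero, Ext.mk₀_comp_mk₀, h1, h2,
        Ext.mk₀_zero, Ext.comp_zero, add_zero, Ext.comp_mk₀_id]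
      rfl
    · simp only [Ext.add_comp, Ext.comp_assoc_of_third_deg_zero, Ext.mk₀_comp_mk₀, h3, h4,
        Ext.mk₀_zero, Ext.comp_zero, zero_add, Ext.comp_mk₀_id]
  right_inv y := by
    have h : ModuleCat.ofHom (LinearMap.fst Cᵐᵒᵖ C P) ≫ inlHom C P +
        ModuleCat.ofHom (LinearMap.snd Cᵐᵒᵖ C P) ≫ inrHom C P = 𝟙 _ :=
      ModuleCat.hom_ext (LinearMap.ext fun x => Prod.ext (add_zero x.1) (zero_add x.2))
    change (y.comp (Ext.mk₀ (ModuleCat.ofHom (LinearMap.fst Cᵐᵒᵖ C P))) (add_zero 2)).comp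
        (Ext.mk₀ (inlHom C P)) (add_zero 2) +
      (y.comp (Ext.mk₀ (ModuleCat.ofHom (LinearMap.snd Cᵐᵒᵖ C P))) (add_zero 2)).comp
        (Ext.mk₀ (inrHom C P)) (add_zero 2) = y
    rw [Ext.comp_assoc_of_third_deg_zero, Ext.comp_assoc_of_third_deg_zero, Ext.mk₀_comp_mk₀,
      Ext.mk₀_comp_mk₀, ← Ext.comp_add, ← Ext.mk₀_add, h, Ext.comp_mk₀_id]
  map_add' x y := by
    change (x.1.toExt + y.1.toExt).comp (Ext.mk₀ (inlHom C P)) (add_zero 2) +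
      (x.2 + y.2).comp (Ext.mk₀ (inrHom C P)) (add_zero 2) = _
    rw [Ext.add_comp, Ext.add_comp]
    abel

theorem extColumnEquiv_apply
    (x : ExtBimod k C × Ext (ModuleCat.of Cᵐᵒᵖ (StdDual k C)) (ModuleCat.of Cᵐᵒᵖ P) 2) :
    extColumnEquiv x = x.1.toExt.comp (Ext.mk₀ (inlHom C P)) (add_zero 2) +
      x.2.comp (Ext.mk₀ (inrHom C P)) (add_zero 2) := rfl

theorem extColumnEquiv_columnEnd (b : OnePointExt k C P)
    (x : ExtBimod k C × Ext (ModuleCat.of Cᵐᵒᵖ (StdDual k C)) (ModuleCat.of Cᵐᵒᵖ P) 2) :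
    (extColumnEquiv x).comp (Ext.mk₀ (columnEnd k C P b)) (add_zero 2) =
      extColumnEquiv (b.a • x.1,
        x.1.toExt.comp (Ext.mk₀ (orbitHom (M := ModuleCat.of Cᵐᵒᵖ P) b.m)) (add_zero 2) +
          b.μ • x.2) := by
  have h : (b.a • x.1).toExt = x.1.toExt.comp (Ext.mk₀ (regMap b.a)) (add_zero 2) := rfl
  rw [extColumnEquiv_apply, extColumnEquiv_apply, h, Ext.add_comp,
    Ext.comp_assoc_of_third_deg_zero, Ext.comp_assoc_of_third_deg_zero,
    Ext.mk₀_comp_mk₀, Ext.mk₀_comp_mk₀, inlHom_columnEnd, inrHom_columnEnd, Ext.add_comp,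
    Ext.mk₀_add, Ext.comp_add, ← Ext.mk₀_comp_mk₀, ← Ext.mk₀_comp_mk₀, ← Ext.mk₀_comp_mk₀,
    mk₀_homSMul, Ext.smul_comp, Ext.mk₀_id_comp, Ext.comp_smul, Ext.smul_comp,
    Ext.comp_assoc_of_third_deg_zero, Ext.comp_assoc_of_third_deg_zero, add_assoc]

theorem extColumnEquiv_dualMap (c : C)
    (x : ExtBimod k C × Ext (ModuleCat.of Cᵐᵒᵖ (StdDual k C)) (ModuleCat.of Cᵐᵒᵖ P) 2) :
    (Ext.mk₀ (dualMap (k := k) c)).comp (extColumnEquiv x) (zero_add 2) =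
      extColumnEquiv (op c • x.1, (Ext.mk₀ (dualMap (k := k) c)).comp x.2 (zero_add 2)) := by
  have h : (op c • x.1).toExt = (Ext.mk₀ (dualMap (k := k) c)).comp x.1.toExt (zero_add 2) := rfl
  rw [extColumnEquiv_apply, extColumnEquiv_apply, h, Ext.comp_add,
    Ext.comp_assoc_of_third_deg_zero, Ext.comp_assoc_of_third_deg_zero]

variable [Module.Projective Cᵐᵒᵖ P]

theorem bijective_inflationDual :
    Function.Bijective (fun y : ExtBimod k (OnePointExt k C P) =>
      (Ext.mk₀ (inflationDual k C P)).comp y.toExt (zero_add 2)) := by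
  refine bijective_precomp_mk₀ (inflationDual k C P) ?_ ?_ _
  · intro φ ψ h
    refine LinearMap.ext fun c : C => ?_
    exact LinearMap.congr_fun h (⟨c, 0, 0⟩ : OnePointExt k C P)
  · intro φ
    let j : C →ₗ[k] OnePointExt k C P :=
      { toFun := fun c => ⟨c, 0, 0⟩
        map_add' := fun _ _ => OnePointExt.ext rfl (add_zero 0).symm (add_zero 0).symm
        map_smul' := fun r _ => OnePointExt.ext rfl (smul_zero r).symm (mul_zero r).symm }
    refine ⟨(show OnePointExt k C P →ₗ[k] k from φ).comp j, ?_⟩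
    refine LinearMap.ext fun b : OnePointExt k C P => ?_
    refine congrArg (show OnePointExt k C P →ₗ[k] k from φ)
      (show (⟨b.a, 0, 0⟩ : OnePointExt k C P) = baseIdem k C P * b from ?_)
    exact OnePointExt.ext (one_mul _).symm (by simp [baseIdem]) (zero_mul _).symm

theorem bijective_columnHom :
    Function.Bijective (fun x : Ext (ModuleCat.of Cᵐᵒᵖ (StdDual k C))
        (ModuleCat.of Cᵐᵒᵖ (C × P)) 2 =>
      (x.mapExactFunctor (inflation k C P)).comp (Ext.mk₀ (columnHom k C P)) (add_zero 2)) := by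
  refine bijective_inflation_comp_mk₀ _ (columnHom k C P) ?_ ?_ 2
  · intro x y h
    exact Prod.ext (congrArg OnePointExt.a h) (congrArg OnePointExt.m h)
  · intro b
    refine ⟨((show OnePointExt k C P from b).a, (show OnePointExt k C P from b).m), ?_⟩
    change _ = (show OnePointExt k C P from b) * baseIdem k C P
    exact OnePointExt.ext (mul_one _).symm
      (show (show OnePointExt k C P from b).m = op (1 : C) • (show OnePointExt k C P from b).m +
        (show OnePointExt k C P from b).μ • (0 : P) by
          rw [op_one, one_smul, smul_zero, add_zero]) (mul_zero _).symm

variable (k C P) in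
/-- Restriction along `DC → DB` identifies `Ext²_B(DB, B)` with `Ext²_B(DC, B)`, for `B = C[P]`. -/
noncomputable def extDualEquiv : ExtBimod k (OnePointExt k C P) ≃+
    Ext ((inflation k C P).obj (ModuleCat.of Cᵐᵒᵖ (StdDual k C)))
      (ModuleCat.of (OnePointExt k C P)ᵐᵒᵖ (OnePointExt k C P)) 2 :=
  AddEquiv.ofBijective ((Ext.mk₀ (inflationDual k C P)).precomp _ (zero_add 2) :
      ExtBimod k (OnePointExt k C P) →+ _) bijective_inflationDual

variable (k C P) in
/-- Inflation followed by the inclusion of the left column identifies `Ext²_C(DC, C × P)` with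
`Ext²_B(DC, B)`, for `B = C[P]`. -/
noncomputable def extInflationEquiv :
    Ext (ModuleCat.of Cᵐᵒᵖ (StdDual k C)) (ModuleCat.of Cᵐᵒᵖ (C × P)) 2 ≃+
    Ext ((inflation k C P).obj (ModuleCat.of Cᵐᵒᵖ (StdDual k C)))
      (ModuleCat.of (OnePointExt k C P)ᵐᵒᵖ (OnePointExt k C P)) 2 :=
  AddEquiv.ofBijective (((Ext.mk₀ (columnHom k C P)).postcomp _ (add_zero 2)).comp
    ((inflation k C P).mapExtAddHom _ _ 2)) bijective_columnHom

variable (k C P) in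
/-- The composite identification of `Ext²_B(DB, B)` with `Ext²_C(DC, C) × Ext²_C(DC, P)`, for
`B = C[P]`. -/
noncomputable def extEquiv : ExtBimod k (OnePointExt k C P) ≃+
    ExtBimod k C × Ext (ModuleCat.of Cᵐᵒᵖ (StdDual k C)) (ModuleCat.of Cᵐᵒᵖ P) 2 :=
  (extDualEquiv k C P).trans (extColumnEquiv.trans (extInflationEquiv k C P)).symm

theorem extEquiv_eq_iff (y : ExtBimod k (OnePointExt k C P))
    (x : ExtBimod k C × Ext (ModuleCat.of Cᵐᵒᵖ (StdDual k C)) (ModuleCat.of Cᵐᵒᵖ P) 2) :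
    extEquiv k C P y = x ↔ (Ext.mk₀ (inflationDual k C P)).comp y.toExt (zero_add 2) =
      ((extColumnEquiv x).mapExactFunctor (inflation k C P)).comp (Ext.mk₀ (columnHom k C P))
        (add_zero 2) :=
  (extColumnEquiv.trans (extInflationEquiv k C P)).symm_apply_eq

/-- The left action of `(c, p, μ)` on a pair `(g, h)` gives `(c g, p g + μ h)`. -/
theorem extEquiv_smul (b : OnePointExt k C P) (y : ExtBimod k (OnePointExt k C P)) :
    extEquiv k C P (b • y) = (b.a • (extEquiv k C P y).1,
      (extEquiv k C P y).1.toExt.comp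
          (Ext.mk₀ (orbitHom (M := ModuleCat.of Cᵐᵒᵖ P) b.m)) (add_zero 2) +
        b.μ • (extEquiv k C P y).2) := by
  have h := (extEquiv_eq_iff y _).1 rfl
  rw [extEquiv_eq_iff, ← extColumnEquiv_columnEnd, Ext.mapExactFunctor_comp,
    Ext.mapExactFunctor_mk₀, Ext.comp_assoc_of_third_deg_zero, Ext.mk₀_comp_mk₀,
    ← columnHom_regMap, ← Ext.mk₀_comp_mk₀, ← Ext.comp_assoc_of_third_deg_zero, ← h,
    Ext.comp_assoc_of_third_deg_zero]
  rfl

/-- The right action of `(c, p, μ)` on a pair `(g, h)` gives `(g c, h c)`. -/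
theorem extEquiv_op_smul (b : OnePointExt k C P) (y : ExtBimod k (OnePointExt k C P)) :
    extEquiv k C P (op b • y) = (op b.a • (extEquiv k C P y).1,
      (Ext.mk₀ (dualMap (k := k) b.a)).comp (extEquiv k C P y).2 (zero_add 2)) := by
  have h := (extEquiv_eq_iff y _).1 rfl
  rw [extEquiv_eq_iff, ← extColumnEquiv_dualMap, Ext.mapExactFunctor_comp,
    Ext.mapExactFunctor_mk₀, Ext.comp_assoc_of_third_deg_zero, ← h, Ext.mk₀_comp_mk₀_assoc,
    ← inflationDual_dualMap, ← Ext.mk₀_comp_mk₀_assoc]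
  rfl

end

end OnePointExt

/-! ### The algebra isomorphism -/

namespace OnePointExt

open Abelian ExtBimod

section

variable {k C P : Type u} [Field k] [Ring C] [Algebra k C] [AddCommGroup P] [Module k P]
  [Module Cᵐᵒᵖ P] [IsScalarTower k Cᵐᵒᵖ P]

/-- The scalars of `k`, acting through `R(C)`, act componentwise. -/
theorem extInduced_algebraMap_smul (μ : k) (p : P)
    (h : Ext (ModuleCat.of Cᵐᵒᵖ (StdDual k C)) (ModuleCat.of Cᵐᵒᵖ P) 2) :
    algebraMap k (RelExt k C)ᵐᵒᵖ μ • (show ExtInduced k (ModuleCat.of Cᵐᵒᵖ P) from (p, h)) =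
      (show ExtInduced k (ModuleCat.of Cᵐᵒᵖ P) from (μ • p, μ • h)) := by
  refine ExtInduced.ext (algebraMap_smul Cᵐᵒᵖ μ p) ?_
  change (Ext.mk₀ (dualMap (k := k) (algebraMap k C μ))).comp h (zero_add 2) +
    (0 : Ext _ _ 2).comp (Ext.mk₀ (orbitHom (M := ModuleCat.of Cᵐᵒᵖ P) p)) (add_zero 2) = μ • h
  rw [Ext.zero_comp, add_zero, Algebra.algebraMap_eq_smul_one, dualMap_smul, mk₀_homSMul,
    dualMap_one, Ext.smul_comp, Ext.mk₀_id_comp]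

variable {Q : Type u} [AddCommGroup Q] [Module k Q]
  [Module (RelExt k C)ᵐᵒᵖ Q] [IsScalarTower k (RelExt k C)ᵐᵒᵖ Q]

/-- The components in `P × Ext²_C(DC, P)` of an element of `R(C[P])`, relative to an identification
`Θ` of the extension bimodule. -/
noncomputable def lowerPart
    (Θ : ExtBimod k (OnePointExt k C P) ≃+
      ExtBimod k C × Ext (ModuleCat.of Cᵐᵒᵖ (StdDual k C)) (ModuleCat.of Cᵐᵒᵖ P) 2)
    (r : RelExt k (OnePointExt k C P)) : ExtInduced k (ModuleCat.of Cᵐᵒᵖ P) :=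
  (r.fst.m, (Θ r.snd).2)

/-- The bijection that regroups `((c, p, μ), (g, h))` as `((c, g), (p, h), μ)`. The identification
`Θ` of the extension bimodule is a variable, so that the proofs below use only its compatibility
with the two actions. -/
noncomputable def relExtEquivFun
    (Θ : ExtBimod k (OnePointExt k C P) ≃+
      ExtBimod k C × Ext (ModuleCat.of Cᵐᵒᵖ (StdDual k C)) (ModuleCat.of Cᵐᵒᵖ P) 2)
    (ψ : ExtInduced k (ModuleCat.of Cᵐᵒᵖ P) ≃ₗ[(RelExt k C)ᵐᵒᵖ] Q) :
    RelExt k (OnePointExt k C P) ≃ OnePointExt k (RelExt k C) Q where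
  toFun r := ⟨(r.fst.a, (Θ r.snd).1), ψ (lowerPart Θ r), r.fst.μ⟩
  invFun s := (⟨s.a.fst, (ψ.symm s.m).1, s.μ⟩, Θ.symm (s.a.snd, (ψ.symm s.m).2))
  left_inv r := by
    have h : ψ.symm (ψ (lowerPart Θ r)) = lowerPart Θ r := ψ.symm_apply_apply _
    refine TrivSqZeroExt.ext (OnePointExt.ext rfl (congrArg Prod.fst h) rfl) ?_
    change Θ.symm ((Θ r.snd).1, (ψ.symm (ψ (lowerPart Θ r))).2) = r.snd
    rw [h]
    exact Θ.symm_apply_apply r.snd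
  right_inv s := by
    have h := Θ.apply_symm_apply (s.a.snd, (ψ.symm s.m).2)
    refine OnePointExt.ext (TrivSqZeroExt.ext rfl (congrArg Prod.fst h)) ?_ rfl
    have h₂ := congrArg Prod.snd h
    have h' : lowerPart Θ (⟨s.a.fst, (ψ.symm s.m).1, s.μ⟩, Θ.symm (s.a.snd, (ψ.symm s.m).2)) =
        ψ.symm s.m := ExtInduced.ext rfl h₂
    exact (congrArg ψ h').trans (ψ.apply_symm_apply s.m)

theorem relExtEquivFun_add
    (Θ : ExtBimod k (OnePointExt k C P) ≃+
      ExtBimod k C × Ext (ModuleCat.of Cᵐᵒᵖ (StdDual k C)) (ModuleCat.of Cᵐᵒᵖ P) 2)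
    (ψ : ExtInduced k (ModuleCat.of Cᵐᵒᵖ P) ≃ₗ[(RelExt k C)ᵐᵒᵖ] Q)
    (r s : RelExt k (OnePointExt k C P)) :
    relExtEquivFun Θ ψ (r + s) = relExtEquivFun Θ ψ r + relExtEquivFun Θ ψ s := by
  have h : Θ (r + s).snd = Θ r.snd + Θ s.snd := map_add Θ r.snd s.snd
  have h₂ := congrArg Prod.snd h
  have h' : lowerPart Θ (r + s) = lowerPart Θ r + lowerPart Θ s :=
    ExtInduced.ext rfl h₂
  exact OnePointExt.ext (TrivSqZeroExt.ext rfl (congrArg Prod.fst h))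
    ((congrArg ψ h').trans (map_add ψ _ _)) rfl

theorem relExtEquivFun_mul
    (Θ : ExtBimod k (OnePointExt k C P) ≃+
      ExtBimod k C × Ext (ModuleCat.of Cᵐᵒᵖ (StdDual k C)) (ModuleCat.of Cᵐᵒᵖ P) 2)
    (hl : ∀ (b : OnePointExt k C P) y, Θ (b • y) = (b.a • (Θ y).1,
      (Θ y).1.toExt.comp (Ext.mk₀ (orbitHom (M := ModuleCat.of Cᵐᵒᵖ P) b.m)) (add_zero 2) +
        b.μ • (Θ y).2))
    (hr : ∀ (b : OnePointExt k C P) y, Θ (op b • y) = (op b.a • (Θ y).1,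
      (Ext.mk₀ (dualMap (k := k) b.a)).comp (Θ y).2 (zero_add 2)))
    (ψ : ExtInduced k (ModuleCat.of Cᵐᵒᵖ P) ≃ₗ[(RelExt k C)ᵐᵒᵖ] Q)
    (r s : RelExt k (OnePointExt k C P)) :
    relExtEquivFun Θ ψ (r * s) = relExtEquivFun Θ ψ r * relExtEquivFun Θ ψ s := by
  have h : Θ (r * s).snd = Θ (r.fst • s.snd) + Θ (op s.fst • r.snd) := map_add Θ _ _
  rw [hl, hr] at h
  have h₂ := congrArg Prod.snd h
  have h' : lowerPart Θ (r * s) = op (relExtEquivFun Θ ψ s).a • lowerPart Θ r +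
      algebraMap k (RelExt k C)ᵐᵒᵖ r.fst.μ • lowerPart Θ s := by
    refine Eq.trans ?_ (congrArg (op (relExtEquivFun Θ ψ s).a • lowerPart Θ r + ·)
      (extInduced_algebraMap_smul r.fst.μ s.fst.m (Θ s.snd).2).symm)
    have hadd : ∀ x y z : Ext (ModuleCat.of Cᵐᵒᵖ (StdDual k C)) (ModuleCat.of Cᵐᵒᵖ P) 2,
        x + y + z = z + x + y := fun x y z => by rw [add_comm, add_assoc]
    exact ExtInduced.ext rfl (h₂.trans (hadd _ _ _))
  refine OnePointExt.ext (TrivSqZeroExt.ext rfl (congrArg Prod.fst h)) ?_ rfl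
  refine (congrArg ψ h').trans ?_
  rw [map_add, map_smul, map_smul, algebraMap_smul]
  rfl

variable (k C P) in
/-- `R(C[P])` is the one-point extension of `R(C)` by `P × Ext²_C(DC, P)`. -/
theorem nonempty_relExt_algEquiv [Module.Projective Cᵐᵒᵖ P]
    (ψ : ExtInduced k (ModuleCat.of Cᵐᵒᵖ P) ≃ₗ[(RelExt k C)ᵐᵒᵖ] Q) :
    Nonempty (RelExt k (OnePointExt k C P) ≃ₐ[k] OnePointExt k (RelExt k C) Q) := by
  let f : RelExt k (OnePointExt k C P) ≃+* OnePointExt k (RelExt k C) Q :=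
    { relExtEquivFun (extEquiv k C P) ψ with
      map_mul' := relExtEquivFun_mul _ extEquiv_smul extEquiv_op_smul ψ
      map_add' := relExtEquivFun_add _ ψ }
  refine ⟨AlgEquiv.ofRingEquiv (f := f) fun c => ?_⟩
  have h : extEquiv k C P (0 : ExtBimod k (OnePointExt k C P)) = 0 := map_zero _
  have h₂ := congrArg Prod.snd h
  have h' : lowerPart (extEquiv k C P) (algebraMap k (RelExt k (OnePointExt k C P)) c) = 0 :=
    ExtInduced.ext rfl h₂
  exact OnePointExt.ext (TrivSqZeroExt.ext rfl (congrArg Prod.fst h))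
    ((congrArg ψ h').trans (map_zero ψ)) rfl

end

end OnePointExt

theorem theorem3p1 {k : Type u} [Field k] (C : Type u) [Ring C] [Algebra k C]
    [FiniteDimensional k C] (hC : GlobalDimLE C 2)
    {n : ℕ} (e : Fin n → C) (he : CompleteOrthogonalIdempotents e)
    (hprim : ∀ j, IsPrimitiveIdem (e j))
    (P : Type u) [AddCommGroup P] [Module k P] [Module Cᵐᵒᵖ P] [IsScalarTower k Cᵐᵒᵖ P]
    [Module.Finite Cᵐᵒᵖ P] [Module.Projective Cᵐᵒᵖ P] :
    (∃ a : Fin n → ℕ, HasMultiplicities e a P) ∧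
    ∀ a : Fin n → ℕ, HasMultiplicities e a P →
      ∀ (Pbar : Type u) [AddCommGroup Pbar] [Module k Pbar] [Module (RelExt k C)ᵐᵒᵖ Pbar]
        [IsScalarTower k (RelExt k C)ᵐᵒᵖ Pbar],
        HasMultiplicities (fun j => (TrivSqZeroExt.inl (e j) : RelExt k C)) a Pbar →
          Nonempty (RelExt k (OnePointExt k C P) ≃ₐ[k] OnePointExt k (RelExt k C) Pbar) := by
  have : FiniteDimensional k Cᵐᵒᵖ := Module.Finite.equiv (opLinearEquiv k)
  have : IsNoetherianRing Cᵐᵒᵖ := IsNoetherianRing.of_finite k Cᵐᵒᵖ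
  have : IsArtinianRing Cᵐᵒᵖ := IsArtinianRing.of_finite k Cᵐᵒᵖ
  refine ⟨exists_hasMultiplicities he hprim P, fun a ha Pbar _ _ _ _ hPbar => ?_⟩
  obtain ⟨ψ⟩ := ExtInduced.nonempty_equiv_of_hasMultiplicities (fun j => (hprim j).1) ha hPbar
  exact OnePointExt.nonempty_relExt_algEquiv k C P ψ
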